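/- **Setting.** Let $M_R\ge 1$, $M_T=1$, $d_1,d_2>0$, $\tau\in\mathbb R$, $\eta>0$, $0<\alpha<1$, $\kappa=\frac{\eta\alpha}{1-\alpha}$, $\sigma^2>0$. Let $\mathbf h_{SR}\in\mathbb C^{M_R}$, $h_{RD}\in\mathbb C$ have $\mathcal{CN}(0,1)$ entries, let $\mathbf h_{RR}\in\mathbb C^{M_R}$ have $\mathcal{CN}(0,\sigma^2)$ entries, all these entries being jointly independent. For the MRC/MRT beamformers $\mathbf w_r=\mathbf h_{SR}/\|\mathbf h_{SR}\|$ and $w_t=\overline{h_{RD}}/|h_{RD}|$ and for $\rho_1,\rho_2>0$, the end-to-end SINR of the full-duplex relay is $$\gamma(\rho_1,\rho_2)=\min\left(\frac{\frac{\rho_1}{d_1^\tau}|\mathbf w_r^\dagger\mathbf h_{SR}|^2}{\frac{\kappa\rho_1}{d_1^\tau}\|\mathbf h_{SR}\|^2|\mathbf w_r^\dagger\mathbf h_{RR}w_t|^2+1},\ \frac{\kappa\rho_2}{d_1^\tau d_2^\tau}\|\mathbf h_{SR}\|^2|h_{RD}w_t|^2\right),$$ and neglecting the noise in the first hop gives $$\gamma^{\mathsf{low}}(\rho_2)=\min\left(\frac{1}{\kappa|\mathbf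 w_r^\dagger\mathbf h_{RR}w_t|^2},\ \frac{\kappa\rho_2}{d_1^\tau d_2^\tau}\|\mathbf h_{SR}\|^2|h_{RD}|^2\right).$$ For a threshold $z>0$ put $F(\rho_1,\rho_2)=\Pr(\gamma(\rho_1,\rho_2)<z)$ and $F^{\mathsf{low}}(\rho_2)=\Pr(\gamma^{\mathsf{low}}(\rho_2)<z)$. Let $G^{m\,n}_{p\,q}$ be the Meijer $G$-function, $K_\nu$ the modified Bessel function of the second kind. **Proposition.** For every $z>0$: 1. for every $\rho_2>0$, $$F^{\mathsf{low}}(\rho_2)=1-\frac{2}{\Gamma(M_R)}\,G^{2\,1}_{2\,3}\!\left(\frac{1}{\kappa\sigma^2z}\,\Big|\,{1,\,M_R\atop 1,\,M_R,\,0}\right)\left(\frac{d_1^\tau d_2^\tau}{\rho_2\kappa}z\right)^{M_R/2}K_{M_R}\!\left(2\sqrt{\frac{d_1^\tau d_2^\tau}{\rho_2\kappa}z}\right);$$ 2. $F^{\mathsf{low}}(\rho_2)\le F(\rho_1,\rho_2)$ for all $\rho_1,\rho_2>0$; 3. $F(\rho_1,\rho_2)-F^{\mathsf{low}}(\rho_2)\to0$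 as $\rho_1\to\infty$, uniformly in $\rho_2>0$; 4. (outage floor) the number $p=1-G^{2\,1}_{2\,3}\!\left(\frac{1}{\kappa\sigma^2z}\,\Big|\,{1,\,M_R\atop 1,\,M_R,\,0}\right)$ is real and positive, $F^{\mathsf{low}}(\rho_2)\to p$ as $\rho_2\to\infty$, and $F(\rho_1,\rho_2)\to p$ as $\rho_1,\rho_2\to\infty$; 5. (zero diversity) for all noise powers $\sigma_R^2,\sigma_D^2>0$, with $\rho_1=P_S/\sigma_R^2$ and $\rho_2=P_S/\sigma_D^2$, both $-\frac{\log F^{\mathsf{low}}(\rho_2)}{\log P_S}$ and $-\frac{\log F(\rho_1,\rho_2)}{\log P_S}$ tend to $0$ as the transmit power $P_S\to\infty$. -/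

import Mathlib

open MeasureTheory ProbabilityTheory Filter Topology
open scoped NNReal Matrix

/-! ### Special functions -/

/-- The Mellin–Barnes integrand of the Meijer function `G^{m n}_{p q}(· | a ; b)`, without the power
of the argument:
`∏_{j ≤ m} Γ(b_j - s) ∏_{k ≤ n} Γ(1 - a_k + s) / (∏_{j > m} Γ(1 - b_j + s) ∏_{k > n} Γ(a_k - s))`. -/
noncomputable def meijerKernel (m n : ℕ) {p q : ℕ} (a : Fin p → ℂ) (b : Fin q → ℂ) (s : ℂ) : ℂ :=
  ((∏ j : Fin q with j.val < m, Complex.Gamma (b j - s)) *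
      ∏ k : Fin p with k.val < n, Complex.Gamma (1 - a k + s)) /
    ((∏ j : Fin q with m ≤ j.val, Complex.Gamma (1 - b j + s)) *
      ∏ k : Fin p with n ≤ k.val, Complex.Gamma (a k - s))

/-- The vertical line `Re s = c` has the poles of all `Γ(b_j - s)`, `j ≤ m`, strictly on its right
and those of all `Γ(1 - a_k + s)`, `k ≤ n`, strictly on its left. -/
def SeparatesPoles (m n : ℕ) {p q : ℕ} (a : Fin p → ℂ) (b : Fin q → ℂ) (c : ℝ) : Prop :=
  (∀ j : Fin q, j.val < m → c < (b j).re) ∧ ∀ k : Fin p, k.val < n → (a k).re - 1 < c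

open Classical in
/-- The Meijer function `G^{m n}_{p q}(x | a ; b)`, for parameters whose two families of poles can be
separated by a vertical line: the integral `(1 / 2πi) ∫ kernel(s) x^s ds`
along such a line `s = c + i t`, from `c - i∞` to `c + i∞` (all such lines give the same value,
by Cauchy's theorem).  If there is no such line, the value is set to `0`. -/
noncomputable def meijerG (m n : ℕ) {p q : ℕ} (a : Fin p → ℂ) (b : Fin q → ℂ) (x : ℂ) : ℂ :=
  if h : ∃ c : ℝ, SeparatesPoles m n a b c then
    (1 / (2 * (Real.pi : ℂ) * Complex.I)) *
      ∫ t : ℝ, meijerKernel m n a b ((h.choose : ℂ) + t * Complex.I) *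
        x ^ ((h.choose : ℂ) + t * Complex.I) * Complex.I
  else 0

/-- The modified Bessel function of the second kind, `K_ν(x) = ∫_0^∞ e^{-x cosh t} cosh(ν t) dt`,
for `x > 0`. -/
noncomputable def besselK (ν x : ℝ) : ℝ :=
  ∫ t in Set.Ioi (0 : ℝ), Real.exp (-x * Real.cosh t) * Real.cosh (ν * t)

/-! ### Channels -/

/-- The law `CN(0, v)` of a circularly symmetric complex Gaussian variable: real and imaginary parts
are independent `N(0, v / 2)`. -/
noncomputable def complexGaussian (v : ℝ≥0) : Measure ℂ :=
  ((gaussianReal 0 (v / 2)).prod (gaussianReal 0 (v / 2))).map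
    Complex.measurableEquivRealProd.symm

/-- Rayleigh fading: the entries of the `MR × 1` channel `hSR` and of the `1 × MT` channel `hRD` are
`CN(0, 1)`, the entries of the `MR × MT` residual loop interference channel `HRR` are `CN(0, σ2)`,
and all these entries are jointly independent. -/
structure IsRayleighModel {Ω : Type*} [MeasurableSpace Ω] (P : Measure Ω) {MR MT : ℕ} (σ2 : ℝ≥0)
    (hSR : Ω → Fin MR → ℂ) (hRD : Ω → Fin MT → ℂ) (HRR : Ω → Matrix (Fin MR) (Fin MT) ℂ) :
    Prop where
  law_SR : ∀ i, HasLaw (fun ω => hSR ω i) (complexGaussian 1) P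
  law_RD : ∀ j, HasLaw (fun ω => hRD ω j) (complexGaussian 1) P
  law_RR : ∀ i j, HasLaw (fun ω => HRR ω i j) (complexGaussian σ2) P
  indep : iIndepFun
    (Sum.elim (fun i ω => hSR ω i)
      (Sum.elim (fun j ω => hRD ω j) (fun ij ω => HRR ω ij.1 ij.2)) :
      Fin MR ⊕ (Fin MT ⊕ (Fin MR × Fin MT)) → Ω → ℂ) P

/-! ### The relay system -/

/-- The Euclidean norm of a complex vector. -/
noncomputable def vecNorm {n : ℕ} (v : Fin n → ℂ) : ℝ := ‖WithLp.toLp 2 v‖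

/-- `κ = η α / (1 - α)`, with `η` the energy conversion efficiency and `α` the fraction of the block
spent on energy harvesting. -/
noncomputable def harvestRatio (η α : ℝ) : ℝ := η * α / (1 - α)

/-- The end-to-end SINR of the full-duplex decode-and-forward relay with receive beamformer `wr` and
transmit beamformer `wt`: the minimum of the SINR of the first hop and the SNR of the second. -/
noncomputable def e2eSINR {MR MT : ℕ} (κ ρ₁ ρ₂ d₁ d₂ τ : ℝ) (hSR : Fin MR → ℂ) (hRD : Fin MT → ℂ)
    (HRR : Matrix (Fin MR) (Fin MT) ℂ) (wr : Fin MR → ℂ) (wt : Fin MT → ℂ) : ℝ :=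
  min ((ρ₁ / d₁ ^ τ * ‖star wr ⬝ᵥ hSR‖ ^ 2) /
      (κ * ρ₁ / d₁ ^ τ * vecNorm hSR ^ 2 * ‖star wr ⬝ᵥ (HRR *ᵥ wt)‖ ^ 2 + 1))
    (κ * ρ₂ / (d₁ ^ τ * d₂ ^ τ) * vecNorm hSR ^ 2 * ‖hRD ⬝ᵥ wt‖ ^ 2)

/-- Maximum ratio combining, `wr = hSR / ‖hSR‖`. -/
noncomputable def mrcVec {MR : ℕ} (hSR : Fin MR → ℂ) : Fin MR → ℂ :=
  fun i => hSR i / (vecNorm hSR : ℂ)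

/-- Maximum ratio transmission, `wt = hRD† / ‖hRD‖`. -/
noncomputable def mrtVec {MT : ℕ} (hRD : Fin MT → ℂ) : Fin MT → ℂ :=
  fun j => star (hRD j) / (vecNorm hRD : ℂ)

/-- The end-to-end SINR of the MRC/MRT scheme. -/
noncomputable def sinrMRC {MR MT : ℕ} (κ ρ₁ ρ₂ d₁ d₂ τ : ℝ) (hSR : Fin MR → ℂ)
    (hRD : Fin MT → ℂ) (HRR : Matrix (Fin MR) (Fin MT) ℂ) : ℝ :=
  e2eSINR κ ρ₁ ρ₂ d₁ d₂ τ hSR hRD HRR (mrcVec hSR) (mrtVec hRD)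

/-- The SINR of the MRC/MRT scheme with the noise term of the first hop neglected:
`min (1 / (κ |wr† HRR wt|²)) (κ ρ₂ / (d₁^τ d₂^τ) ‖hSR‖² ‖hRD‖²)`. -/
noncomputable def sinrMRCLow {MR MT : ℕ} (κ ρ₂ d₁ d₂ τ : ℝ) (hSR : Fin MR → ℂ)
    (hRD : Fin MT → ℂ) (HRR : Matrix (Fin MR) (Fin MT) ℂ) : ℝ :=
  min (1 / (κ * ‖star (mrcVec hSR) ⬝ᵥ (HRR *ᵥ mrtVec hRD)‖ ^ 2))
    (κ * ρ₂ / (d₁ ^ τ * d₂ ^ τ) * vecNorm hSR ^ 2 * vecNorm hRD ^ 2)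

/-- The exact outage probability of the MRC/MRT scheme at the threshold `z`. -/
noncomputable def outageMRC {Ω : Type*} [MeasurableSpace Ω] (P : Measure Ω) {MR MT : ℕ}
    (hSR : Ω → Fin MR → ℂ) (hRD : Ω → Fin MT → ℂ) (HRR : Ω → Matrix (Fin MR) (Fin MT) ℂ)
    (κ d₁ d₂ τ z ρ₁ ρ₂ : ℝ) : ℝ :=
  P.real {ω | sinrMRC κ ρ₁ ρ₂ d₁ d₂ τ (hSR ω) (hRD ω) (HRR ω) < z}

/-- The outage probability at the threshold `z` for the SINR with noise-free first hop. -/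
noncomputable def outageMRCLow {Ω : Type*} [MeasurableSpace Ω] (P : Measure Ω) {MR MT : ℕ}
    (hSR : Ω → Fin MR → ℂ) (hRD : Ω → Fin MT → ℂ) (HRR : Ω → Matrix (Fin MR) (Fin MT) ℂ)
    (κ d₁ d₂ τ z ρ₂ : ℝ) : ℝ :=
  P.real {ω | sinrMRCLow κ ρ₂ d₁ d₂ τ (hSR ω) (hRD ω) (HRR ω) < z}

/-- An outage probability, as a function of the transmit power, has diversity order `d` if
`- log Pout / log PS → d` as `PS → ∞`. -/
def HasDiversityOrder (Pout : ℝ → ℝ) (d : ℝ) : Prop :=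
  Tendsto (fun PS : ℝ => -Real.log (Pout PS) / Real.log PS) atTop (𝓝 d)

/-! Write $q = \mathbf w_r^\dagger \mathbf h_{RR} w_t$. For fixed nonzero `hSR` and `hRD` both
beamformers are unit vectors, so $q$ is a linear combination of independent
$\mathcal{CN}(0,\sigma^2)$ entries with unit coefficient vector, hence again
$\mathcal{CN}(0,\sigma^2)$. This conditional law does not depend on `hSR` and `hRD`, so $q$ is
independent of them (`IsRayleighModel.hasLaw_loopGain`).

Without first-hop noise, the complement of outage is therefore an intersection of two independent
events, $|q|^2 \le 1/(\kappa z)$ and $\|\mathbf h_{SR}\|^2 |h_{RD}|^2 \ge c$. The first has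
probability $1 - e^{-1/(\kappa\sigma^2 z)}$, and the Meijer function of the statement is just $1 -
e^{-x}$ (`meijerG_eq_one_sub_exp_neg`, by Mellin inversion). The second is the average of
$e^{-c/y^2}$ over the radial law of $y = \|\mathbf h_{SR}\|$, which is a Bessel integral
(`stdComplexGaussian_prod_real_ge`).

For the exact SINR put $Y = \|\mathbf h_{SR}\|^2(1 - z\kappa|q|^2)$. The first hop fails when
$\rho_1 Y/d_1^\tau < z$; without noise it fails when $1 - z\kappa|q|^2 < 0$. Almost surely the
noise-free outage event is thus contained in the exact one, and their difference lies in $\{|Y| < z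
d_1^\tau/\rho_1\}$. That set does not involve $\rho_2$ and shrinks to the null event $Y = 0$, whence
the uniform convergence. As $\rho_2 \to \infty$, $c \to 0$ and only the floor $e^{-1/(\kappa\sigma^2
z)} > 0$ remains; a positive limit forces zero diversity. -/

/-! ### The Meijer function as an inverse Mellin transform -/

/-- The parameter $M$ stands in both rows, so $\Gamma(M-s)$ cancels; what is left is
$\Gamma(1-s)\Gamma(s)/\Gamma(1+s)$. -/
theorem meijerKernel_eq_Gamma_div {M : ℕ} (hM : 1 ≤ M) {s : ℂ} (h0 : 0 < s.re) (h1 : s.re < 1) :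
    meijerKernel 2 1 ![1, (M : ℂ)] ![1, (M : ℂ), 0] s = Complex.Gamma (1 - s) / s := by
  have hs : s ≠ 0 := fun h => by simp [h] at h0
  have hM' : (1 : ℝ) ≤ M := by exact_mod_cast hM
  have hG : Complex.Gamma (M - s) ≠ 0 := Complex.Gamma_ne_zero_of_re_pos (by simp; linarith)
  have hGs : Complex.Gamma s ≠ 0 := Complex.Gamma_ne_zero_of_re_pos h0
  simp [meijerKernel, Finset.prod_filter, Fin.prod_univ_three]
  rw [add_comm 1 s, Complex.Gamma_add_one s hs]
  field_simp

theorem one_sub_exp_neg_isBigO_atTop :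
    (fun t : ℝ => (1 - Complex.exp (-t) : ℂ)) =O[atTop] fun t : ℝ => t ^ (-(0 : ℝ)) := by
  refine Asymptotics.IsBigO.of_bound 2 ?_
  filter_upwards [eventually_ge_atTop 0] with t ht
  simp only [neg_zero, Real.rpow_zero, norm_one, mul_one]
  refine (norm_sub_le _ _).trans ?_
  rw [Complex.norm_exp]
  have : Real.exp (-(t : ℂ)).re ≤ 1 := by simpa using ht
  simp only [norm_one]; linarith

theorem one_sub_exp_neg_isBigO_zero :
    (fun t : ℝ => (1 - Complex.exp (-t) : ℂ)) =O[𝓝[>] 0] fun t : ℝ => t ^ (-(-1 : ℝ)) := by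
  have hd : HasDerivAt (fun t : ℝ => (1 - Complex.exp (-t) : ℂ)) 1 0 := by
    have := ((Complex.ofRealCLM.hasDerivAt (x := 0)).neg.cexp).const_sub 1
    simpa using this
  have := hd.isBigO_sub.mono (nhdsWithin_le_nhds (s := Set.Ioi 0))
  simpa using this

theorem mellinConvergent_one_sub_exp_neg {s : ℂ} (h0 : -1 < s.re) (h1 : s.re < 0) :
    MellinConvergent (fun t : ℝ => (1 - Complex.exp (-t) : ℂ)) s :=
  mellinConvergent_of_isBigO_rpow
    ((by fun_prop : Continuous fun t : ℝ => (1 - Complex.exp (-t) : ℂ)).locallyIntegrable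
      |>.locallyIntegrableOn _)
    one_sub_exp_neg_isBigO_atTop h1 one_sub_exp_neg_isBigO_zero h0

/-- Integration by parts against $t^s/s$ leaves the Euler integral at $s+1$. The boundary terms are
$O(t^{\Re s+1})$ at $0$ and $O(t^{\Re s})$ at infinity, so both vanish in this strip. -/
theorem mellin_one_sub_exp_neg {s : ℂ} (h0 : -1 < s.re) (h1 : s.re < 0) :
    mellin (fun t : ℝ => (1 - Complex.exp (-t) : ℂ)) s = -(Complex.Gamma (s + 1) / s) := by
  have hs : s ≠ 0 := fun h => by simp [h] at h1
  have hconv := mellinConvergent_one_sub_exp_neg h0 h1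
  have hu : ∀ t ∈ Set.Ioi (0 : ℝ),
      HasDerivAt (fun t : ℝ => (1 - Complex.exp (-t) : ℂ)) (Complex.exp (-t)) t := fun t _ => by
    simpa using ((Complex.ofRealCLM.hasDerivAt (x := t)).neg.cexp).const_sub 1
  have hv : ∀ t ∈ Set.Ioi (0 : ℝ),
      HasDerivAt (fun t : ℝ => (t : ℂ) ^ s / s) ((t : ℂ) ^ (s - 1)) t := fun t ht => by
    simpa using hasDerivAt_ofReal_cpow_const' (ne_of_gt ht) (r := s - 1)
      (by simpa [sub_eq_iff_eq_add] using hs)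
  have hGi : IntegrableOn (fun t : ℝ => Complex.exp (-t) * (t : ℂ) ^ s) (Set.Ioi 0) := by
    simpa using Complex.GammaIntegral_convergent (s := s + 1) (by simp; linarith)
  have key := integral_Ioi_mul_deriv_eq_deriv_mul (a' := (0 : ℂ)) (b' := (0 : ℂ)) hu hv
    (by
      refine IntegrableOn.congr_fun hconv (fun t _ => ?_) measurableSet_Ioi
      simp [mul_comm])
    (by
      refine IntegrableOn.congr_fun (hGi.div_const s) (fun t _ => ?_) measurableSet_Ioi
      simp [mul_div_assoc]) ?_ ?_
  · rw [Complex.Gamma_eq_integral (by simp; linarith), Complex.GammaIntegral, mellin]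
    simp only [smul_eq_mul, add_sub_cancel_right]
    simp only [← mul_div_assoc, integral_div] at key
    simp_rw [mul_comm _ (1 - Complex.exp _)]
    rw [key]; simp
  · have hb : (fun t : ℝ => (1 - Complex.exp (-t) : ℂ) * ((t : ℂ) ^ s / s)) =O[𝓝[>] 0]
        fun t : ℝ => t ^ (s.re + 1) := by
      have h2 : (fun t : ℝ => (t : ℂ) ^ s / s) =O[𝓝[>] 0] fun t : ℝ => t ^ s.re := by
        refine Asymptotics.IsBigO.of_bound ‖s‖⁻¹ ?_
        filter_upwards [self_mem_nhdsWithin] with t ht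
        rw [norm_div, Complex.norm_cpow_eq_rpow_re_of_pos ht, Real.norm_of_nonneg
          (Real.rpow_nonneg (le_of_lt ht) _), div_eq_inv_mul]
      refine (one_sub_exp_neg_isBigO_zero.mul h2).trans_eventuallyEq ?_
      filter_upwards [self_mem_nhdsWithin] with t ht
      rw [← Real.rpow_add ht]; congr 1; ring
    refine hb.trans_tendsto ?_
    have := (Real.continuousAt_rpow_const 0 (s.re + 1) (Or.inr (by linarith))).tendsto
    rw [Real.zero_rpow (by linarith)] at this
    exact this.mono_left nhdsWithin_le_nhds
  · have hb : (fun t : ℝ => (1 - Complex.exp (-t) : ℂ) * ((t : ℂ) ^ s / s)) =O[atTop]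
        fun t : ℝ => t ^ s.re := by
      have h2 : (fun t : ℝ => (t : ℂ) ^ s / s) =O[atTop] fun t : ℝ => t ^ s.re := by
        refine Asymptotics.IsBigO.of_bound ‖s‖⁻¹ ?_
        filter_upwards [eventually_gt_atTop 0] with t ht
        rw [norm_div, Complex.norm_cpow_eq_rpow_re_of_pos ht, Real.norm_of_nonneg
          (Real.rpow_nonneg (le_of_lt ht) _), div_eq_inv_mul]
      simpa using one_sub_exp_neg_isBigO_atTop.mul h2
    refine hb.trans_tendsto ?_
    simpa using tendsto_rpow_neg_atTop (y := -s.re) (by linarith)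

theorem Complex.norm_Gamma_le_Gamma_re {s : ℂ} (hs : 0 < s.re) :
    ‖Complex.Gamma s‖ ≤ Real.Gamma s.re := by
  rw [Complex.Gamma_eq_integral hs, Real.Gamma_eq_integral hs, Complex.GammaIntegral]
  refine (norm_integral_le_integral_norm _).trans_eq
    (setIntegral_congr_fun measurableSet_Ioi fun t ht => ?_)
  simp only [norm_mul, Complex.norm_cpow_eq_rpow_re_of_pos ht, Complex.sub_re, Complex.one_re,
    Complex.norm_real, Real.norm_of_nonneg (Real.exp_pos _).le]

/-- No Stirling estimate is needed: one step of the recursion gives $|\Gamma(s+1)/s| \le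
\Gamma(\sigma+2)/(|s||s+1|)$, which decays like $1/(1+y^2)$ on the line. -/
theorem verticalIntegrable_Gamma_div {σ : ℝ} (h0 : -1 < σ) (h1 : σ < 0) :
    Complex.VerticalIntegrable (fun s => -(Complex.Gamma (s + 1) / s)) σ := by
  have hne : ∀ y : ℝ, (σ + y * Complex.I : ℂ) ≠ 0 := fun y h => by
    have := congrArg Complex.re h; simp at this; linarith
  have hne1 : ∀ y : ℝ, (σ + y * Complex.I + 1 : ℂ) ≠ 0 := fun y h => by
    have := congrArg Complex.re h; simp at this; linarith
  have hcont : Continuous fun y : ℝ => -(Complex.Gamma (σ + y * Complex.I + 1) /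
      (σ + y * Complex.I)) := by
    refine (Continuous.div ?_ (by fun_prop) hne).neg
    refine continuous_iff_continuousAt.2 fun y => ?_
    refine ContinuousAt.comp (g := Complex.Gamma)
      (Complex.differentiableAt_Gamma _ fun m h => ?_).continuousAt (by fun_prop)
    have := congrArg Complex.re h
    simp at this
    have hm : (0 : ℝ) ≤ m := m.cast_nonneg
    linarith
  -- The smaller of the distances from the line to $0$ and to $-1$. As $r \le 1$ too, both $|s|$ and
  -- $|s+1|$ are at least $r\sqrt{1+y^2}$.
  set r := min (-σ) (σ + 1) with hr
  have hr0 : 0 < r := lt_min (by linarith) (by linarith)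
  have hlow : ∀ a y : ℝ, r ≤ |a| → r * √(1 + y ^ 2) ≤ ‖(a + y * Complex.I : ℂ)‖ := by
    intro a y ha
    have hr1 : r ≤ 1 := (min_le_right _ _).trans (by linarith)
    rw [Complex.norm_add_mul_I]
    refine Real.le_sqrt_of_sq_le ?_
    rw [mul_pow, Real.sq_sqrt (by positivity)]
    have h2 : r ^ 2 ≤ a ^ 2 := by rw [← sq_abs a]; gcongr
    have h3 : r ^ 2 ≤ 1 := by nlinarith
    nlinarith [sq_nonneg y]
  refine Integrable.mono' (g := fun y : ℝ => (Real.Gamma (σ + 2) / r ^ 2) * (1 + y ^ 2)⁻¹)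
    (integrable_inv_one_add_sq.const_mul _) hcont.aestronglyMeasurable (ae_of_all _ fun y => ?_)
  have hG : ‖Complex.Gamma (σ + y * Complex.I + 1)‖ ≤
      Real.Gamma (σ + 2) / ‖(σ + y * Complex.I + 1 : ℂ)‖ := by
    rw [le_div_iff₀ (norm_pos_iff.2 (hne1 y)), mul_comm, ← norm_mul,
      ← Complex.Gamma_add_one _ (hne1 y)]
    have := Complex.norm_Gamma_le_Gamma_re (s := σ + y * Complex.I + 1 + 1) (by simp; linarith)
    rwa [show (σ + y * Complex.I + 1 + 1 : ℂ).re = σ + 2 by simp; ring] at this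
  have hGp : 0 ≤ Real.Gamma (σ + 2) := (Real.Gamma_pos_of_pos (by linarith)).le
  have e1 := hlow σ y (by rw [abs_of_neg h1]; exact min_le_left _ _)
  have e2 := hlow (σ + 1) y (by rw [abs_of_pos (by linarith)]; exact min_le_right _ _)
  have hq : 0 < √(1 + y ^ 2) := by positivity
  rw [norm_neg, norm_div]
  calc _ ≤ (Real.Gamma (σ + 2) / ‖(σ + y * Complex.I + 1 : ℂ)‖) / ‖(σ + y * Complex.I : ℂ)‖ := by
        gcongr
    _ ≤ (Real.Gamma (σ + 2) / (r * √(1 + y ^ 2))) / (r * √(1 + y ^ 2)) := by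
        gcongr
        refine e2.trans_eq ?_
        congr 1; push_cast; ring
    _ = _ := by
        rw [div_div, mul_mul_mul_comm, ← sq, ← sq, Real.sq_sqrt (by positivity), ← div_eq_mul_inv,
          div_div]

/-- `G^{2 1}_{2 3}(x | 1, M ; 1, M, 0) = 1 - e^{-x}`. -/
theorem meijerG_eq_one_sub_exp_neg {M : ℕ} (hM : 1 ≤ M) {x : ℝ} (hx : 0 < x) :
    meijerG 2 1 ![1, (M : ℂ)] ![1, (M : ℂ), 0] (x : ℂ) = ((1 - Real.exp (-x) : ℝ) : ℂ) := by
  have hM' : (1 : ℝ) ≤ M := by exact_mod_cast hM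
  have hsep : ∀ c : ℝ, SeparatesPoles 2 1 ![1, (M : ℂ)] ![1, (M : ℂ), 0] c ↔ 0 < c ∧ c < 1 := by
    intro c
    simp only [SeparatesPoles, Fin.forall_fin_succ]
    simp
    constructor
    · rintro ⟨⟨a, b⟩, c⟩; exact ⟨c, a⟩
    · rintro ⟨a, b⟩; exact ⟨⟨b, by linarith⟩, a⟩
  have hex : ∃ c : ℝ, SeparatesPoles 2 1 ![1, (M : ℂ)] ![1, (M : ℂ), 0] c :=
    ⟨1 / 2, (hsep _).2 (by norm_num)⟩
  rw [meijerG, dif_pos hex]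
  -- About the chosen abscissa only $0 < c < 1$ is known, and the inversion works for every such
  -- $c$.
  obtain ⟨hc0, hc1⟩ := (hsep _).1 hex.choose_spec
  set c := hex.choose
  have hre : ∀ y : ℝ, (((-c : ℝ) : ℂ) + y * Complex.I).re = -c := fun y => by simp
  have hmel : ∀ y : ℝ, mellin (fun t : ℝ => (1 - Complex.exp (-t) : ℂ))
      (((-c : ℝ) : ℂ) + y * Complex.I) =
      -(Complex.Gamma ((((-c : ℝ) : ℂ) + y * Complex.I) + 1) /
        (((-c : ℝ) : ℂ) + y * Complex.I)) := fun y =>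
    mellin_one_sub_exp_neg (by rw [hre]; linarith) (by rw [hre]; linarith)
  -- Mellin inversion integrates against $x^{-s}$, the Meijer integral against $x^{s}$: hence the
  -- line $\Re s = -c$ here and the reversal $y \mapsto -y$ below.
  have hinv := mellinInv_mellin_eq (-c) (fun t : ℝ => (1 - Complex.exp (-t) : ℂ)) hx
    (mellinConvergent_one_sub_exp_neg (by simpa using hc1) (by simpa using hc0)) (by
      have := verticalIntegrable_Gamma_div (σ := -c) (by linarith) (by linarith)
      simpa only [Complex.VerticalIntegrable, hmel] using this) (by fun_prop)
  have hcast : ((1 - Real.exp (-x) : ℝ) : ℂ) = 1 - Complex.exp (-x) := by push_cast; rfl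
  rw [hcast, ← hinv, mellinInv]
  simp only [hmel, smul_eq_mul]
  rw [integral_mul_const, ← integral_neg_eq_self]
  rw [Complex.real_smul]
  have : (1 / (2 * (Real.pi : ℂ) * Complex.I)) = ((1 / (2 * Real.pi) : ℝ) : ℂ) / Complex.I := by
    push_cast; field_simp
  rw [this, div_mul_eq_mul_div, mul_comm _ Complex.I, mul_left_comm,
    mul_div_cancel_left₀ _ Complex.I_ne_zero]
  congr 1
  refine integral_congr_ae (ae_of_all _ fun y => ?_)
  simp only
  rw [meijerKernel_eq_Gamma_div hM (by simpa using hc0) (by simpa using hc1)]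
  have e : ((-c : ℝ) : ℂ) + (y : ℂ) * Complex.I = -((c : ℂ) + ((-y : ℝ) : ℂ) * Complex.I) := by
    push_cast; ring
  rw [e, neg_neg, div_neg, neg_neg, mul_comm, sub_eq_neg_add]

/-! ### The Bessel integral -/

theorem integral_eq_integral_Ioi_add_comp_neg {f : ℝ → ℝ} (hf : Integrable f) :
    ∫ t, f t = ∫ t in Set.Ioi (0 : ℝ), (f t + f (-t)) := by
  rw [integral_add hf.integrableOn hf.comp_neg.integrableOn, integral_comp_neg_Ioi, neg_zero,
    add_comm]
  exact (intervalIntegral.integral_Iic_add_Ioi hf.integrableOn hf.integrableOn).symm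

theorem integrableOn_pow_mul_exp_neg_sq_sub_div (M : ℕ) {c : ℝ} (hc : 0 ≤ c) :
    IntegrableOn (fun y : ℝ => y ^ (2 * M - 1) * Real.exp (-y ^ 2 - c / y ^ 2)) (Set.Ioi 0) := by
  have h0 : IntegrableOn (fun y : ℝ => y ^ (2 * M - 1) * Real.exp (-y ^ 2)) (Set.Ioi 0) := by
    have := integrableOn_rpow_mul_exp_neg_rpow (p := 2) (s := ((2 * M - 1 : ℕ) : ℝ))
      (by have : (0 : ℝ) ≤ ((2 * M - 1 : ℕ) : ℝ) := Nat.cast_nonneg _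
          linarith) (by norm_num)
    simpa using this
  refine Integrable.mono' h0 (by fun_prop) (ae_restrict_of_forall_mem measurableSet_Ioi ?_)
  intro y hy
  have hy' : (0 : ℝ) < y := hy
  rw [Real.norm_of_nonneg (by positivity)]
  gcongr
  have : 0 ≤ c / y ^ 2 := by positivity
  linarith

/-- The substitution $y^2 = \sqrt c\, e^t$ balances the exponent, $y^2 + c/y^2 = 2\sqrt c\cosh t$,
and turns $y^{2M-1}\,dy$ into $\tfrac12 c^{M/2} e^{Mt}\,dt$. Folding the line onto $t > 0$ replaces
$e^{Mt}$ by $2\cosh(Mt)$. -/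
theorem integral_pow_mul_exp_neg_sq_sub_div {M : ℕ} (hM : 1 ≤ M) {c : ℝ} (hc : 0 < c) :
    ∫ y in Set.Ioi (0 : ℝ), y ^ (2 * M - 1) * Real.exp (-y ^ 2 - c / y ^ 2) =
      c ^ ((M : ℝ) / 2) * besselK M (2 * √c) := by
  set f : ℝ → ℝ := fun t => Real.sqrt (Real.sqrt c) * Real.exp (t / 2) with hf
  have hq : 0 < √√c := by positivity
  have himg : f '' Set.univ = Set.Ioi 0 := by
    ext y
    simp only [Set.image_univ, Set.mem_range, Set.mem_Ioi, hf]
    constructor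
    · rintro ⟨t, rfl⟩; positivity
    · intro hy
      refine ⟨2 * Real.log (y / √√c), ?_⟩
      rw [mul_div_cancel_left₀ _ two_ne_zero, Real.exp_log (by positivity)]
      field_simp
  have hder : ∀ t ∈ Set.univ, HasDerivWithinAt f (f t / 2) Set.univ t := fun t _ => by
    have h : f t / 2 = √√c * (Real.exp (t / 2) * (1 / 2)) := by simp only [hf]; ring
    rw [h]
    exact (((hasDerivAt_id' t).div_const 2).exp.const_mul (√√c)).hasDerivWithinAt
  have hinj : Set.InjOn f Set.univ := fun a _ b _ h => by
    have := Real.exp_injective (mul_left_cancel₀ hq.ne' h)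
    linarith
  have hsq : ∀ t, f t ^ 2 = √c * Real.exp t := fun t => by
    simp only [hf, mul_pow, Real.sq_sqrt (Real.sqrt_nonneg c), ← Real.exp_nat_mul]
    congr 2; push_cast; ring
  have hpt : ∀ t, |f t / 2| • (f t ^ (2 * M - 1) * Real.exp (-f t ^ 2 - c / f t ^ 2)) =
      c ^ ((M : ℝ) / 2) / 2 * (Real.exp (M * t) * Real.exp (-(2 * √c) * Real.cosh t)) := fun t => by
    have hft : 0 < f t := by positivity
    have hexp : -f t ^ 2 - c / f t ^ 2 = -(2 * √c) * Real.cosh t := by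
      rw [hsq, Real.cosh_eq, Real.exp_neg]
      have := Real.mul_self_sqrt hc.le
      have h3 : 0 < √c := by positivity
      have : c / (√c * Real.exp t) = √c * (Real.exp t)⁻¹ := by
        nth_rw 1 [← this]; field_simp
      rw [this]; ring
    have hpow : f t * f t ^ (2 * M - 1) = c ^ ((M : ℝ) / 2) * Real.exp (M * t) := by
      rw [← pow_succ', show 2 * M - 1 + 1 = 2 * M by omega, pow_mul, hsq, mul_pow,
        ← Real.exp_nat_mul, Real.sqrt_eq_rpow, ← Real.rpow_mul_natCast hc.le]
      congr 2; ring
    rw [abs_of_pos (by positivity), hexp, smul_eq_mul]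
    linear_combination (1 / 2 * Real.exp (-(2 * √c) * Real.cosh t)) * hpow
  -- Folding requires integrability over the whole line, which is carried over through the same
  -- substitution.
  have hint := integrableOn_pow_mul_exp_neg_sq_sub_div M hc.le
  rw [← himg, integrableOn_image_iff_integrableOn_abs_deriv_smul MeasurableSet.univ hder hinj,
    integrableOn_univ] at hint
  simp_rw [hpt] at hint
  rw [← himg, integral_image_eq_integral_abs_deriv_smul MeasurableSet.univ hder hinj,
    setIntegral_univ]
  simp_rw [hpt]
  rw [integral_eq_integral_Ioi_add_comp_neg hint, besselK, ← integral_const_mul]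
  refine setIntegral_congr_fun measurableSet_Ioi fun t _ => ?_
  simp only [Real.cosh_neg, Real.cosh_eq (M * t), mul_neg]
  ring

/-! ### Complex Gaussian laws through characteristic functions -/

instance isProbabilityMeasure_complexGaussian (v : ℝ≥0) :
    IsProbabilityMeasure (complexGaussian v) :=
  Measure.isProbabilityMeasure_map (MeasurableEquiv.measurable _).aemeasurable

theorem charFun_complexGaussian (v : ℝ≥0) (t : ℂ) :
    charFun (complexGaussian v) t = Complex.exp (-(v * ‖t‖ ^ 2 / 4 : ℝ)) := by
  have h : ∀ p : ℝ × ℝ, Complex.exp (inner ℝ (Complex.measurableEquivRealProd.symm p) t *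
      Complex.I) = Complex.exp (t.re * p.1 * Complex.I) * Complex.exp (t.im * p.2 * Complex.I) := by
    intro p
    rw [← Complex.exp_add, Complex.measurableEquivRealProd_symm_apply, Complex.inner]
    congr 1
    simp
    ring
  rw [charFun_apply, complexGaussian, MeasureTheory.integral_map_equiv]
  simp_rw [h]
  rw [integral_prod_mul (fun x : ℝ => Complex.exp (t.re * x * Complex.I))
    (fun y : ℝ => Complex.exp (t.im * y * Complex.I)), ← charFun_apply_real, ← charFun_apply_real,
    charFun_gaussianReal, charFun_gaussianReal, ← Complex.exp_add, Complex.sq_norm,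
    Complex.normSq_apply]
  congr 1
  push_cast
  ring

/-- The product of the coordinate characteristic functions depends on $t$ only through its norm.
This isotropy is all that is used below about Gaussian vectors. -/
theorem charFun_pi_complexGaussian {ι : Type*} [Fintype ι] (v : ℝ≥0) (t : PiLp 2 fun _ : ι => ℂ) :
    charFun ((Measure.pi fun _ : ι => complexGaussian v).map (WithLp.toLp 2)) t =
      Complex.exp (-(v * ‖t‖ ^ 2 / 4 : ℝ)) := by
  rw [charFun_pi]
  simp_rw [charFun_complexGaussian]
  rw [← Complex.exp_sum, PiLp.norm_sq_eq_of_L2, Finset.mul_sum, Finset.sum_div,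
    Finset.sum_neg_distrib]
  push_cast
  rfl

/-- A linear combination with unit coefficient vector of independent `CN(0, v)` variables has the
law `CN(0, v)`. -/
theorem map_sum_mul_pi_complexGaussian {ι : Type*} [Fintype ι] (v : ℝ≥0) (u : ι → ℂ)
    (hu : ∑ i, ‖u i‖ ^ 2 = 1) :
    (Measure.pi fun _ : ι => complexGaussian v).map (fun x => ∑ i, u i * x i) =
      complexGaussian v := by
  have hm : Measurable fun x : ι → ℂ => ∑ i, u i * x i := by fun_prop
  have := Measure.isProbabilityMeasure_map (μ := Measure.pi fun _ : ι => complexGaussian v)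
    hm.aemeasurable
  refine Measure.ext_of_charFun (funext fun t => ?_)
  -- Moving the coefficients to the other side gives the vector $(\bar u_i t)_i$, whose norm is
  -- $|t|$ because $u$ is a unit vector.
  have h : ∀ x : ι → ℂ, inner ℝ (∑ i, u i * x i) t =
      inner ℝ (WithLp.toLp 2 x) (WithLp.toLp 2 fun i => star (u i) * t) := by
    intro x
    rw [PiLp.inner_apply, sum_inner]
    refine Finset.sum_congr rfl fun i _ => ?_
    simp only [Complex.inner]
    simp
    ring
  have e := charFun_pi_complexGaussian v (WithLp.toLp 2 fun i => star (u i) * t)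
  rw [charFun_apply, integral_map (by fun_prop) (by fun_prop)] at e
  rw [charFun_apply, integral_map hm.aemeasurable (by fun_prop)]
  simp_rw [h]
  rw [e, charFun_complexGaussian, PiLp.norm_sq_eq_of_L2]
  simp [mul_pow, ← Finset.sum_mul, hu]

/-! ### Radial distribution of isotropic Gaussian measures -/

section Radial

variable {V : Type*} [NormedAddCommGroup V] [InnerProductSpace ℝ V] [FiniteDimensional ℝ V]
  [MeasurableSpace V] [BorelSpace V]

theorem charFun_withDensity_exp_neg_norm_sq {v : ℝ} (hv : 0 < v) (t : V) :
    charFun ((volume : Measure V).withDensity fun x => ENNReal.ofReal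
      ((Real.pi * v) ^ (-(Module.finrank ℝ V / 2 : ℝ)) * Real.exp (-‖x‖ ^ 2 / v))) t =
      Complex.exp (-(v * ‖t‖ ^ 2 / 4 : ℝ)) := by
  have hpos : 0 < Real.pi * v := by positivity
  rw [charFun_apply, integral_withDensity_eq_integral_toReal_smul (by fun_prop)
    (ae_of_all _ fun _ => ENNReal.ofReal_lt_top)]
  have h : ∀ x : V, (ENNReal.ofReal ((Real.pi * v) ^ (-(Module.finrank ℝ V / 2 : ℝ)) *
      Real.exp (-‖x‖ ^ 2 / v))).toReal • Complex.exp (inner ℝ x t * Complex.I) =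
      (((Real.pi * v) ^ (-(Module.finrank ℝ V / 2 : ℝ)) : ℝ) : ℂ) *
        Complex.exp (-((v : ℂ)⁻¹) * ‖x‖ ^ 2 + Complex.I * inner ℝ t x) := fun x => by
    rw [ENNReal.toReal_ofReal (by positivity), Complex.real_smul, Complex.exp_add,
      real_inner_comm]
    push_cast
    rw [mul_assoc]
    congr 3 <;> ring_nf
  simp_rw [h]
  rw [integral_const_mul, GaussianFourier.integral_cexp_neg_mul_sq_norm_add (by
    rw [← Complex.ofReal_inv, Complex.ofReal_re]; positivity), ← mul_assoc, div_inv_eq_mul]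
  have : ((Real.pi : ℂ) * v) ^ ((Module.finrank ℝ V : ℂ) / 2) =
      (((Real.pi * v) ^ ((Module.finrank ℝ V / 2 : ℝ)) : ℝ) : ℂ) := by
    rw [Complex.ofReal_cpow hpos.le]; push_cast; rfl
  rw [this, ← Complex.ofReal_mul, ← Real.rpow_add hpos, neg_add_cancel, Real.rpow_zero,
    Complex.ofReal_one, one_mul]
  congr 1
  have : (v : ℂ) ≠ 0 := by exact_mod_cast hv.ne'
  push_cast
  rw [Complex.I_sq]
  field_simp

/-- Finite measures are determined by their characteristic functions. Assuming only the
characteristic function lets one argument serve both $\mathcal{CN}(0,v)$ on $\mathbb C$ and the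
vectors of such entries. -/
theorem eq_withDensity_of_charFun_eq {μ : Measure V} [IsFiniteMeasure μ] {v : ℝ} (hv : 0 < v)
    (h : ∀ t, charFun μ t = Complex.exp (-(v * ‖t‖ ^ 2 / 4 : ℝ))) :
    μ = (volume : Measure V).withDensity fun x => ENNReal.ofReal
      ((Real.pi * v) ^ (-(Module.finrank ℝ V / 2 : ℝ)) * Real.exp (-‖x‖ ^ 2 / v)) := by
  have hint : Integrable (fun x : V => Real.exp (-‖x‖ ^ 2 / v)) := by
    refine (GaussianFourier.integrable_cexp_neg_mul_sq_norm_add (V := V) (b := (v⁻¹ : ℝ))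
      (by simpa using hv) 0 0).norm.congr (ae_of_all _ fun x => ?_)
    simp only [inner_zero_left, Complex.norm_exp]
    congr 1
    rw [← Complex.ofReal_neg, ← Complex.ofReal_pow, ← Complex.ofReal_mul]
    simp only [Complex.ofReal_zero, mul_zero, add_zero, Complex.ofReal_re]
    ring
  have : IsFiniteMeasure ((volume : Measure V).withDensity fun x => ENNReal.ofReal
      ((Real.pi * v) ^ (-(Module.finrank ℝ V / 2 : ℝ)) * Real.exp (-‖x‖ ^ 2 / v))) :=
    isFiniteMeasure_withDensity_ofReal (hint.const_mul _).2
  exact Measure.ext_of_charFun (funext fun t => by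
    rw [h, charFun_withDensity_exp_neg_norm_sq hv])

theorem measure_norm_eq_zero_of_charFun_eq [Nontrivial V] {μ : Measure V} [IsFiniteMeasure μ]
    {v : ℝ} (hv : 0 < v) (h : ∀ t, charFun μ t = Complex.exp (-(v * ‖t‖ ^ 2 / 4 : ℝ))) (r : ℝ) :
    μ {x | ‖x‖ = r} = 0 := by
  rw [eq_withDensity_of_charFun_eq hv h]
  refine withDensity_absolutelyContinuous _ _ ?_
  have := Measure.addHaar_sphere (volume : Measure V) 0 r
  simpa [Metric.sphere, dist_zero_right] using this

/-- Polar coordinates. The constant, which contains the volume of the unit ball, is left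
unevaluated, since total mass one determines it later. -/
theorem exists_integral_norm_eq_of_charFun_eq [Nontrivial V] {μ : Measure V} [IsFiniteMeasure μ]
    {v : ℝ} (hv : 0 < v) (h : ∀ t, charFun μ t = Complex.exp (-(v * ‖t‖ ^ 2 / 4 : ℝ))) :
    ∃ K : ℝ, ∀ g : ℝ → ℝ, ∫ x, g ‖x‖ ∂μ =
      K * ∫ y in Set.Ioi (0 : ℝ), y ^ (Module.finrank ℝ V - 1) * (Real.exp (-y ^ 2 / v) * g y) := by
  refine ⟨Module.finrank ℝ V * (volume : Measure V).real (Metric.ball 0 1) *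
    (Real.pi * v) ^ (-(Module.finrank ℝ V / 2 : ℝ)), fun g => ?_⟩
  rw [eq_withDensity_of_charFun_eq hv h, integral_withDensity_eq_integral_toReal_smul (by fun_prop)
    (ae_of_all _ fun _ => ENNReal.ofReal_lt_top)]
  have h : ∀ x : V, (ENNReal.ofReal ((Real.pi * v) ^ (-(Module.finrank ℝ V / 2 : ℝ)) *
      Real.exp (-‖x‖ ^ 2 / v))).toReal • g ‖x‖ = (Real.pi * v) ^ (-(Module.finrank ℝ V / 2 : ℝ)) *
      (fun y => Real.exp (-y ^ 2 / v) * g y) ‖x‖ := fun x => by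
    rw [ENNReal.toReal_ofReal (by positivity), smul_eq_mul, mul_assoc]
  simp_rw [h]
  rw [integral_const_mul, integral_fun_norm_addHaar (volume : Measure V)
    (fun y => Real.exp (-y ^ 2 / v) * g y)]
  simp only [nsmul_eq_mul, smul_eq_mul]
  ring

/-- Testing with $g = 1$ fixes the constant through a Gamma integral. -/
theorem integral_norm_eq_of_charFun_eq {M : ℕ} (hM : 1 ≤ M) (hV : Module.finrank ℝ V = 2 * M)
    {μ : Measure V} [IsProbabilityMeasure μ]
    {v : ℝ} (hv : 0 < v) (h : ∀ t, charFun μ t = Complex.exp (-(v * ‖t‖ ^ 2 / 4 : ℝ)))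
    (g : ℝ → ℝ) : ∫ x, g ‖x‖ ∂μ = 2 / (v ^ M * Real.Gamma M) *
      ∫ y in Set.Ioi (0 : ℝ), y ^ (2 * M - 1) * (Real.exp (-y ^ 2 / v) * g y) := by
  have hnt : Nontrivial V := Module.nontrivial_of_finrank_pos (R := ℝ) (by omega)
  obtain ⟨K, hK⟩ := exists_integral_norm_eq_of_charFun_eq hv h
  have h1 := hK fun _ => 1
  have hMc : ((2 * M - 1 : ℕ) : ℝ) = 2 * M - 1 := by
    rw [Nat.cast_sub (by omega)]; push_cast; ring
  have hM' : (1 : ℝ) ≤ M := by exact_mod_cast hM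
  have h2 : ∫ y in Set.Ioi (0 : ℝ), y ^ (2 * M - 1) * (Real.exp (-y ^ 2 / v) * 1) =
      v ^ M * Real.Gamma M / 2 := by
    have := integral_rpow_mul_exp_neg_mul_rpow (p := 2) (q := ((2 * M - 1 : ℕ) : ℝ)) (b := v⁻¹)
      two_pos (by linarith) (by positivity)
    simp only [Real.rpow_natCast, Real.rpow_ofNat] at this
    rw [hMc, show -(2 * (M : ℝ) - 1 + 1) / 2 = -M by ring, show (2 * (M : ℝ) - 1 + 1) / 2 = M by ring,
      Real.inv_rpow hv.le, Real.rpow_neg hv.le, inv_inv, Real.rpow_natCast] at this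
    rw [show v ^ M * Real.Gamma M / 2 = v ^ M * (1 / 2) * Real.Gamma M by ring, ← this]
    refine integral_congr_ae (ae_of_all _ fun y => ?_)
    simp only [mul_one]
    congr 2
    ring
  rw [hV, h2] at h1
  simp only [integral_const, probReal_univ, smul_eq_mul, mul_one] at h1
  have hG : 0 < Real.Gamma M := Real.Gamma_pos_of_pos (by linarith)
  have hKv : K = 2 / (v ^ M * Real.Gamma M) := by
    field_simp
    linarith
  rw [hK, hKv, hV]

/-- In real dimension two the radial density is proportional to $y e^{-y^2/v}$, which has an
elementary antiderivative: the squared norm is exponential with mean $v$. -/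
theorem measureReal_norm_sq_ge_of_charFun_eq (hV : Module.finrank ℝ V = 2)
    {μ : Measure V} [IsProbabilityMeasure μ]
    {v : ℝ} (hv : 0 < v) (h : ∀ t, charFun μ t = Complex.exp (-(v * ‖t‖ ^ 2 / 4 : ℝ)))
    {a : ℝ} (ha : 0 ≤ a) : μ.real {x | a ≤ ‖x‖ ^ 2} = Real.exp (-a / v) := by
  have hnt : Nontrivial V := Module.nontrivial_of_finrank_pos (R := ℝ) (by omega)
  -- Spheres are null, so the closed condition may be replaced by one matching the open half-line
  -- `Set.Ioi`.
  have hs : {x : V | a ≤ ‖x‖ ^ 2} =ᵐ[μ] {x : V | √a < ‖x‖} := by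
    have h0 := measure_norm_eq_zero_of_charFun_eq hv h √a
    have : ∀ᵐ x ∂μ, ‖x‖ ≠ √a := by simpa [ae_iff] using h0
    filter_upwards [this] with x hx
    apply propext
    change a ≤ ‖x‖ ^ 2 ↔ √a < ‖x‖
    rw [← Real.sqrt_le_left (norm_nonneg x)]
    exact ⟨fun h => lt_of_le_of_ne h hx.symm, le_of_lt⟩
  rw [measureReal_congr hs, ← integral_indicator_one (measurableSet_lt (by fun_prop) (by fun_prop))]
  have e := integral_norm_eq_of_charFun_eq (M := 1) le_rfl hV hv h ((Set.Ioi √a).indicator 1)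
  have e1 : ∀ x : V, (Set.Ioi √a).indicator (1 : ℝ → ℝ) ‖x‖ =
    Set.indicator {x : V | √a < ‖x‖} 1 x := fun x => rfl
  simp_rw [e1] at e
  rw [e]
  have e2 : ∀ y : ℝ, y ^ (2 * 1 - 1) * (Real.exp (-y ^ 2 / v) * (Set.Ioi √a).indicator 1 y) =
      (Set.Ioi √a).indicator (fun y => y * Real.exp (-y ^ 2 / v)) y := fun y => by
    by_cases hy : y ∈ Set.Ioi √a <;> simp [hy]
  simp_rw [e2]
  rw [setIntegral_indicator measurableSet_Ioi,
    Set.inter_eq_right.2 (Set.Ioi_subset_Ioi (Real.sqrt_nonneg a))]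
  have hd : ∀ y : ℝ, HasDerivAt (fun y => -(v / 2) * Real.exp (-y ^ 2 / v))
      (y * Real.exp (-y ^ 2 / v)) y := fun y => by
    have := (((hasDerivAt_pow 2 y).neg.div_const v).exp.const_mul (-(v / 2)))
    refine this.congr_deriv ?_
    simp
    field_simp
  have ht : Tendsto (fun y : ℝ => -(v / 2) * Real.exp (-y ^ 2 / v)) atTop (𝓝 0) := by
    have : Tendsto (fun y : ℝ => -y ^ 2 / v) atTop atBot :=
      (tendsto_neg_atTop_atBot.comp (tendsto_pow_atTop two_ne_zero)).atBot_div_const hv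
    simpa using (Real.tendsto_exp_atBot.comp this).const_mul (-(v / 2))
  rw [integral_Ioi_of_hasDerivAt_of_nonneg (hd _).continuousAt.continuousWithinAt
    (fun y _ => hd y) (fun y hy => mul_nonneg ((Real.sqrt_nonneg a).trans (le_of_lt hy))
      (Real.exp_pos _).le) ht]
  rw [Real.sq_sqrt ha]
  simp
  field_simp

end Radial

/-! ### Beamforming vectors and channel gains -/

theorem measurable_vecNorm {n : ℕ} : Measurable (vecNorm : (Fin n → ℂ) → ℝ) := by
  unfold vecNorm; fun_prop

theorem vecNorm_nonneg {n : ℕ} (x : Fin n → ℂ) : 0 ≤ vecNorm x := norm_nonneg _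

theorem vecNorm_sq {n : ℕ} (x : Fin n → ℂ) : vecNorm x ^ 2 = ∑ i, ‖x i‖ ^ 2 := by
  rw [vecNorm, PiLp.norm_sq_eq_of_L2]

theorem sum_norm_mrcVec_sq {n : ℕ} {x : Fin n → ℂ} (hx : vecNorm x ≠ 0) :
    ∑ i, ‖mrcVec x i‖ ^ 2 = 1 := by
  simp only [mrcVec, norm_div, div_pow, Complex.norm_real, Real.norm_eq_abs, sq_abs]
  rw [← Finset.sum_div, ← vecNorm_sq, div_self (pow_ne_zero 2 hx)]

theorem sum_norm_mrtVec_sq {n : ℕ} {x : Fin n → ℂ} (hx : vecNorm x ≠ 0) :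
    ∑ i, ‖mrtVec x i‖ ^ 2 = 1 := by
  simp only [mrtVec, norm_div, div_pow, Complex.norm_real, Real.norm_eq_abs, sq_abs, norm_star]
  rw [← Finset.sum_div, ← vecNorm_sq, div_self (pow_ne_zero 2 hx)]

theorem norm_star_mrcVec_dotProduct {n : ℕ} (x : Fin n → ℂ) :
    ‖star (mrcVec x) ⬝ᵥ x‖ = vecNorm x := by
  have h : star (mrcVec x) ⬝ᵥ x = ((vecNorm x ^ 2 / vecNorm x : ℝ) : ℂ) := by
    rw [vecNorm_sq, Finset.sum_div]
    simp only [dotProduct, Pi.star_apply, mrcVec, star_div₀, Complex.star_def, Complex.conj_ofReal]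
    push_cast
    refine Finset.sum_congr rfl fun i _ => ?_
    rw [div_mul_eq_mul_div, Complex.conj_mul']
  rw [h, Complex.norm_real, Real.norm_of_nonneg (by have := vecNorm_nonneg x; positivity)]
  rcases eq_or_ne (vecNorm x) 0 with h0 | h0
  · simp [h0]
  · field_simp

theorem norm_dotProduct_mrtVec {n : ℕ} (x : Fin n → ℂ) : ‖x ⬝ᵥ mrtVec x‖ = vecNorm x := by
  have h : mrtVec x = star (mrcVec x) := by
    ext i
    simp [mrtVec, mrcVec]
  rw [h, dotProduct_comm, norm_star_mrcVec_dotProduct]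

/-- The residual loop interference `wr† HRR wt` after MRC/MRT beamforming. -/
noncomputable def loopGain {MR MT : ℕ} (hSR : Fin MR → ℂ) (hRD : Fin MT → ℂ)
    (HRR : Matrix (Fin MR) (Fin MT) ℂ) : ℂ :=
  star (mrcVec hSR) ⬝ᵥ (HRR *ᵥ mrtVec hRD)

theorem loopGain_eq_sum {MR MT : ℕ} (hSR : Fin MR → ℂ) (hRD : Fin MT → ℂ)
    (HRR : Matrix (Fin MR) (Fin MT) ℂ) :
    loopGain hSR hRD HRR =
      ∑ ij : Fin MR × Fin MT, star (mrcVec hSR ij.1) * mrtVec hRD ij.2 * HRR ij.1 ij.2 := by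
  rw [Fintype.sum_prod_type]
  simp only [loopGain, dotProduct, Matrix.mulVec, Finset.mul_sum, Pi.star_apply]
  exact Finset.sum_congr rfl fun i _ => Finset.sum_congr rfl fun j _ => by ring

/-- The law of a vector of `n` independent `CN(0, 1)` variables. -/
noncomputable abbrev stdComplexGaussian (n : ℕ) : Measure (Fin n → ℂ) :=
  Measure.pi fun _ => complexGaussian 1

theorem charFun_map_toLp_stdComplexGaussian (n : ℕ) (t : PiLp 2 fun _ : Fin n => ℂ) :
    charFun ((stdComplexGaussian n).map (WithLp.toLp 2)) t =
      Complex.exp (-(1 * ‖t‖ ^ 2 / 4 : ℝ)) := by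
  simpa using charFun_pi_complexGaussian (ι := Fin n) 1 t

instance isProbabilityMeasure_map_toLp (n : ℕ) : IsProbabilityMeasure
    ((stdComplexGaussian n).map (WithLp.toLp 2 : _ → PiLp 2 fun _ : Fin n => ℂ)) :=
  Measure.isProbabilityMeasure_map (by fun_prop)

theorem finrank_real_piLp (n : ℕ) : Module.finrank ℝ (PiLp 2 fun _ : Fin n => ℂ) = 2 * n := by
  rw [LinearEquiv.finrank_eq (WithLp.linearEquiv 2 ℝ (Fin n → ℂ)), Module.finrank_pi_fintype]
  simp [mul_comm]

theorem ae_vecNorm_ne_zero {n : ℕ} (hn : 1 ≤ n) : ∀ᵐ x ∂stdComplexGaussian n, vecNorm x ≠ 0 := by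
  have : Nontrivial (PiLp 2 fun _ : Fin n => ℂ) :=
    Module.nontrivial_of_finrank_pos (R := ℝ) (by rw [finrank_real_piLp]; omega)
  have h := measure_norm_eq_zero_of_charFun_eq one_pos
    (charFun_map_toLp_stdComplexGaussian n) 0
  rw [Measure.map_apply (by fun_prop) (measurableSet_eq_fun (by fun_prop) (by fun_prop))] at h
  rw [ae_iff]
  simp only [not_not]
  exact h

theorem stdComplexGaussian_real_vecNorm_sq_ge {a : ℝ} (ha : 0 ≤ a) :
    (stdComplexGaussian 1).real {x | a ≤ vecNorm x ^ 2} = Real.exp (-a) := by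
  have h := measureReal_norm_sq_ge_of_charFun_eq (by rw [finrank_real_piLp]) one_pos
    (charFun_map_toLp_stdComplexGaussian 1) ha
  rw [map_measureReal_apply (by fun_prop) (measurableSet_le (by fun_prop) (by fun_prop))] at h
  simpa [vecNorm] using h

/-- Given the first vector $x \ne 0$, the exponential law of the second gain gives probability
$e^{-c/\|x\|^2}$. Averaging over the radial law of $\|x\|$ yields the Bessel integral. -/
theorem stdComplexGaussian_prod_real_ge {M : ℕ} (hM : 1 ≤ M) {c : ℝ} (hc : 0 < c) :
    ((stdComplexGaussian M).prod (stdComplexGaussian 1)).real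
      {p | c ≤ vecNorm p.1 ^ 2 * vecNorm p.2 ^ 2} =
      2 / Real.Gamma M * (c ^ ((M : ℝ) / 2) * besselK M (2 * √c)) := by
  have hms : MeasurableSet {p : (Fin M → ℂ) × (Fin 1 → ℂ) |
      c ≤ vecNorm p.1 ^ 2 * vecNorm p.2 ^ 2} :=
    measurableSet_le measurable_const
      (((measurable_vecNorm.comp measurable_fst).pow_const 2).mul
        ((measurable_vecNorm.comp measurable_snd).pow_const 2))
  rw [Measure.real, Measure.prod_apply hms, ← integral_toReal
    (measurable_measure_prodMk_left hms).aemeasurable (ae_of_all _ fun _ => measure_lt_top _ _)]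
  have h1 : ∀ᵐ x ∂stdComplexGaussian M, ((stdComplexGaussian 1) (Prod.mk x ⁻¹'
      {p : (Fin M → ℂ) × (Fin 1 → ℂ) | c ≤ vecNorm p.1 ^ 2 * vecNorm p.2 ^ 2})).toReal =
      (fun y => Real.exp (-(c / y ^ 2))) ‖(WithLp.toLp 2 x : PiLp 2 fun _ : Fin M => ℂ)‖ := by
    filter_upwards [ae_vecNorm_ne_zero hM] with x hx
    have hx' : 0 < vecNorm x ^ 2 := pow_pos (lt_of_le_of_ne (vecNorm_nonneg x) hx.symm) 2
    change (stdComplexGaussian 1).real _ = Real.exp (-(c / vecNorm x ^ 2))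
    rw [← stdComplexGaussian_real_vecNorm_sq_ge (by positivity)]
    congr 1
    ext y
    simp [div_le_iff₀' hx']
  rw [integral_congr_ae h1, ← integral_map (μ := stdComplexGaussian M)
    (f := fun x : PiLp 2 (fun _ : Fin M => ℂ) => (fun y => Real.exp (-(c / y ^ 2))) ‖x‖)
    (by fun_prop) (by
      refine Measurable.aestronglyMeasurable ?_
      exact Real.measurable_exp.comp (measurable_const.div (measurable_norm.pow_const 2)).neg),
    integral_norm_eq_of_charFun_eq hM (finrank_real_piLp M) one_pos
    (charFun_map_toLp_stdComplexGaussian M) fun y => Real.exp (-(c / y ^ 2)), ← integral_pow_mul_exp_neg_sq_sub_div hM hc]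
  simp only [one_pow, one_mul, div_one, ← Real.exp_add, ← sub_eq_add_neg]

theorem complexGaussian_real_norm_sq_ge {v : ℝ≥0} (hv : 0 < v) {a : ℝ} (ha : 0 ≤ a) :
    (complexGaussian v).real {x | a ≤ ‖x‖ ^ 2} = Real.exp (-a / v) :=
  measureReal_norm_sq_ge_of_charFun_eq Complex.finrank_real_complex (by exact_mod_cast hv)
    (charFun_complexGaussian v) ha

theorem ae_complexGaussian_norm_sq_ne {v : ℝ≥0} (hv : 0 < v) (a : ℝ) :
    ∀ᵐ x ∂complexGaussian v, ‖x‖ ^ 2 ≠ a := by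
  have h := measure_norm_eq_zero_of_charFun_eq (by exact_mod_cast hv)
    (charFun_complexGaussian v) √a
  have h' : ∀ᵐ x ∂complexGaussian v, ‖x‖ ≠ √a := by simpa [ae_iff] using h
  filter_upwards [h'] with x hx hxa
  exact hx (by rw [← hxa, Real.sqrt_sq (norm_nonneg x)])

theorem complexGaussian_real_norm_sq_le {v : ℝ≥0} (hv : 0 < v) {a : ℝ} (ha : 0 ≤ a) :
    (complexGaussian v).real {x | ‖x‖ ^ 2 ≤ a} = 1 - Real.exp (-a / v) := by
  rw [← complexGaussian_real_norm_sq_ge hv ha,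
    ← probReal_compl_eq_one_sub (measurableSet_le (by fun_prop) (by fun_prop))]
  refine measureReal_congr ?_
  filter_upwards [ae_complexGaussian_norm_sq_ne hv a] with x hx
  apply propext
  change ‖x‖ ^ 2 ≤ a ↔ ¬ a ≤ ‖x‖ ^ 2
  rw [not_le]
  exact ⟨fun h => lt_of_le_of_ne h hx, le_of_lt⟩

/-! ### Joint law of the channels and the loop interference -/

section Model

variable {Ω : Type*} [MeasurableSpace Ω] {P : Measure Ω} [IsProbabilityMeasure P] {MR MT : ℕ}
  {σ2 : ℝ≥0} {hSR : Ω → Fin MR → ℂ} {hRD : Ω → Fin MT → ℂ} {HRR : Ω → Matrix (Fin MR) (Fin MT) ℂ}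

/-- The loop interference after beamforming has the law `CN(0, σ2)` and is independent of the other
channels. -/
theorem IsRayleighModel.hasLaw_loopGain (h : IsRayleighModel P σ2 hSR hRD HRR) (hMR : 1 ≤ MR)
    (hMT : 1 ≤ MT) :
    HasLaw (fun ω => ((hSR ω, hRD ω), loopGain (hSR ω) (hRD ω) (HRR ω)))
      (((stdComplexGaussian MR).prod (stdComplexGaussian MT)).prod (complexGaussian σ2)) P := by
  set F : Fin MR ⊕ (Fin MT ⊕ (Fin MR × Fin MT)) → Ω → ℂ :=
    Sum.elim (fun i ω => hSR ω i)
      (Sum.elim (fun j ω => hRD ω j) (fun ij ω => HRR ω ij.1 ij.2)) with hF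
  set ν : Fin MR ⊕ (Fin MT ⊕ (Fin MR × Fin MT)) → Measure ℂ :=
    Sum.elim (fun _ => complexGaussian 1)
      (Sum.elim (fun _ => complexGaussian 1) (fun _ => complexGaussian σ2)) with hν
  have hlaw : ∀ k, HasLaw (F k) (ν k) P := by
    rintro (i | j | ij)
    exacts [h.law_SR i, h.law_RD j, h.law_RR ij.1 ij.2]
  have : ∀ k, IsProbabilityMeasure (ν k) := by
    rintro (i | j | ij) <;> simp only [hν, Sum.elim_inl, Sum.elim_inr] <;> infer_instance
  have hae : AEMeasurable (fun ω k => F k ω) P :=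
    aemeasurable_pi_lambda _ fun k => (hlaw k).aemeasurable
  have hmap : P.map (fun ω k => F k ω) = Measure.pi ν := by
    rw [(iIndepFun_iff_map_fun_eq_pi_map fun k => (hlaw k).aemeasurable).1 h.indep]
    congr 1
    ext1 k
    exact (hlaw k).map_eq
  -- The next three maps only regroup the flat product of all entries as ((`hSR`, `hRD`), `HRR`).
  have m1 := measurePreserving_sumPiEquivProdPi ν
  have m2 := (MeasurePreserving.id (Measure.pi fun i => ν (Sum.inl i))).prod
    (measurePreserving_sumPiEquivProdPi fun k => ν (Sum.inr k))
  have m3 := (measurePreserving_prodAssoc (stdComplexGaussian MR) (stdComplexGaussian MT)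
    (Measure.pi fun _ : Fin MR × Fin MT => complexGaussian σ2)).symm
  have hmrc : Measurable (mrcVec : (Fin MR → ℂ) → Fin MR → ℂ) :=
    measurable_pi_lambda _ fun i => (measurable_pi_apply i).div
      (Complex.measurable_ofReal.comp measurable_vecNorm)
  have hmrt : Measurable (mrtVec : (Fin MT → ℂ) → Fin MT → ℂ) :=
    measurable_pi_lambda _ fun i => ((continuous_star (R := ℂ)).measurable.comp
      (measurable_pi_apply i)).div
      (Complex.measurable_ofReal.comp measurable_vecNorm)
  -- A skew product: for almost every pair of channels the coefficients
  -- $\overline{w_{r,i}}\,w_{t,j}$ form a unit vector, so each fibre map sends the Gaussian matrix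
  -- law to the same $\mathcal{CN}(0,\sigma^2)$. A fibre law that does not vary produces the product
  -- measure.
  have m4 := (MeasurePreserving.id ((stdComplexGaussian MR).prod
    (stdComplexGaussian MT))).skew_product
    (μc := Measure.pi fun _ : Fin MR × Fin MT => complexGaussian σ2) (μd := complexGaussian σ2)
    (g := fun g x => ∑ ij : Fin MR × Fin MT, star (mrcVec g.1 ij.1) * mrtVec g.2 ij.2 * x ij) (by
      refine Finset.measurable_sum _ fun ij _ => Measurable.mul (Measurable.mul ?_ ?_) ?_
      · exact continuous_star.measurable.comp ((measurable_pi_apply ij.1).comp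
          (hmrc.comp (measurable_fst.comp measurable_fst)))
      · exact (measurable_pi_apply ij.2).comp (hmrt.comp (measurable_snd.comp measurable_fst))
      · exact (measurable_pi_apply ij).comp measurable_snd) (by
      filter_upwards [Measure.quasiMeasurePreserving_fst.ae (ae_vecNorm_ne_zero hMR),
        Measure.quasiMeasurePreserving_snd.ae (ae_vecNorm_ne_zero hMT)] with g h1 h2
      refine map_sum_mul_pi_complexGaussian σ2 (fun ij : Fin MR × Fin MT =>
        star (mrcVec g.1 ij.1) * mrtVec g.2 ij.2) ?_
      simp only [norm_mul, norm_star, mul_pow, Fintype.sum_prod_type, ← Finset.mul_sum,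
        sum_norm_mrtVec_sq h2, mul_one, sum_norm_mrcVec_sq h1])
  have m := m4.comp (m3.comp (m2.comp m1))
  have hcomp := (HasLaw.mk hae hmap : HasLaw _ _ P)
  refine (m.comp_hasLaw hcomp).congr (ae_of_all _ fun ω => ?_)
  simp only [loopGain_eq_sum]
  rfl

end Model

/-! ### Small-ball limits -/

/-- Continuity from above: the sets decrease to $\{Y = 0\}$, which is null. -/
theorem tendsto_measureReal_abs_lt_zero {α : Type*} [MeasurableSpace α] {μ : Measure α}
    [IsFiniteMeasure μ] {Y : α → ℝ} (hY : AEMeasurable Y μ) (h0 : ∀ᵐ x ∂μ, Y x ≠ 0) :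
    Tendsto (fun ε : ℝ => μ.real {x | |Y x| < ε}) (𝓝[>] 0) (𝓝 0) := by
  have h := tendsto_measure_biInter_gt (μ := μ) (s := fun ε : ℝ => {x | |Y x| < ε}) (a := 0)
    (fun r _ => nullMeasurableSet_lt
      (continuous_abs.measurable.comp_aemeasurable hY) aemeasurable_const)
    (fun i j _ hij x hx => lt_of_lt_of_le hx hij) ⟨1, one_pos, measure_ne_top _ _⟩
  have hz : μ (⋂ r : ℝ, ⋂ (_ : r > 0), {x | |Y x| < r}) = 0 := by
    refine measure_mono_null (fun x hx => ?_) (ae_iff.1 h0)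
    simp only [Set.mem_iInter] at hx
    change ¬ (Y x ≠ 0)
    rw [not_not]
    by_contra hne
    exact lt_irrefl |Y x| (hx |Y x| (abs_pos.2 hne))
  rw [hz] at h
  exact (ENNReal.tendsto_toReal ENNReal.zero_ne_top).comp h

theorem measurable_vecNorm_sq_mul_vecNorm_sq {m n : ℕ} :
    Measurable fun p : (Fin m → ℂ) × (Fin n → ℂ) => vecNorm p.1 ^ 2 * vecNorm p.2 ^ 2 :=
  ((measurable_vecNorm.comp measurable_fst).pow_const 2).mul
    ((measurable_vecNorm.comp measurable_snd).pow_const 2)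

theorem tendsto_stdComplexGaussian_prod_real_ge {m n : ℕ} (hm : 1 ≤ m) (hn : 1 ≤ n) :
    Tendsto (fun c : ℝ => ((stdComplexGaussian m).prod (stdComplexGaussian n)).real
      {p | c ≤ vecNorm p.1 ^ 2 * vecNorm p.2 ^ 2}) (𝓝[>] 0) (𝓝 1) := by
  have h := tendsto_measureReal_abs_lt_zero
    (μ := (stdComplexGaussian m).prod (stdComplexGaussian n))
    measurable_vecNorm_sq_mul_vecNorm_sq.aemeasurable (by
      filter_upwards [Measure.quasiMeasurePreserving_fst.ae (ae_vecNorm_ne_zero hm),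
        Measure.quasiMeasurePreserving_snd.ae (ae_vecNorm_ne_zero hn)] with p h1 h2
      positivity)
  have h' := h.const_sub 1
  rw [sub_zero] at h'
  refine h'.congr fun c => ?_
  rw [← probReal_compl_eq_one_sub (measurableSet_lt
    measurable_vecNorm_sq_mul_vecNorm_sq.abs measurable_const)]
  congr 1
  ext p
  simp

theorem harvestRatio_pos {η α : ℝ} (hη : 0 < η) (hα₀ : 0 < α) (hα₁ : α < 1) :
    0 < harvestRatio η α :=
  div_pos (mul_pos hη hα₀) (sub_pos.2 hα₁)

/-! ### Outage events as inequalities between channel gains -/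

section Thresholds

variable {MR MT : ℕ} {κ ρ₁ ρ₂ d₁ d₂ τ z : ℝ} {hSR : Fin MR → ℂ} {hRD : Fin MT → ℂ}
  {HRR : Matrix (Fin MR) (Fin MT) ℂ}

/-- `hQ` removes the convention `1 / 0 = 0`, which would count perfect interference cancellation as
an outage. The excluded event is null. -/
theorem le_sinrMRCLow_iff (hκ : 0 < κ) (hρ₂ : 0 < ρ₂) (hd₁ : 0 < d₁) (hd₂ : 0 < d₂) (hz : 0 < z)
    (hQ : ‖loopGain hSR hRD HRR‖ ^ 2 ≠ 0) :
    z ≤ sinrMRCLow κ ρ₂ d₁ d₂ τ hSR hRD HRR ↔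
      ‖loopGain hSR hRD HRR‖ ^ 2 ≤ 1 / (κ * z) ∧
        d₁ ^ τ * d₂ ^ τ / (ρ₂ * κ) * z ≤ vecNorm hSR ^ 2 * vecNorm hRD ^ 2 := by
  have hQ' : 0 < ‖loopGain hSR hRD HRR‖ ^ 2 := lt_of_le_of_ne (by positivity) hQ.symm
  have h1 : 0 < d₁ ^ τ := Real.rpow_pos_of_pos hd₁ τ
  have h2 : 0 < d₂ ^ τ := Real.rpow_pos_of_pos hd₂ τ
  rw [sinrMRCLow, ← loopGain, le_min_iff, le_div_iff₀ (by positivity), le_div_iff₀ (by positivity)]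
  refine and_congr ?_ ?_
  · rw [show ‖loopGain hSR hRD HRR‖ ^ 2 * (κ * z) = z * (κ * ‖loopGain hSR hRD HRR‖ ^ 2) by ring]
  · rw [div_mul_eq_mul_div, div_mul_eq_mul_div, div_mul_eq_mul_div, le_div_iff₀ (by positivity),
      div_le_iff₀ (by positivity)]
    rw [show vecNorm hSR ^ 2 * vecNorm hRD ^ 2 * (ρ₂ * κ) =
      κ * ρ₂ * vecNorm hSR ^ 2 * vecNorm hRD ^ 2 by ring, mul_comm z]

/-- The noise term keeps the denominator positive, so it can be cleared without exceptions. The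
resulting form isolates the factor whose sign decides the noise-free outage. -/
theorem sinrMRC_lt_iff (hκ : 0 < κ) (hρ₁ : 0 < ρ₁) (hd₁ : 0 < d₁) :
    sinrMRC κ ρ₁ ρ₂ d₁ d₂ τ hSR hRD HRR < z ↔
      ρ₁ / d₁ ^ τ * (vecNorm hSR ^ 2 * (1 - z * κ * ‖loopGain hSR hRD HRR‖ ^ 2)) < z ∨
      κ * ρ₂ / (d₁ ^ τ * d₂ ^ τ) * vecNorm hSR ^ 2 * vecNorm hRD ^ 2 < z := by
  have h1 : 0 < d₁ ^ τ := Real.rpow_pos_of_pos hd₁ τ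
  rw [sinrMRC, e2eSINR, ← loopGain, norm_star_mrcVec_dotProduct, norm_dotProduct_mrtVec,
    min_lt_iff, div_lt_iff₀ (by positivity)]
  refine or_congr_left ?_
  rw [← sub_pos, ← sub_pos (b := ρ₁ / d₁ ^ τ * (vecNorm hSR ^ 2 * _))]
  ring_nf

theorem sinrMRCLow_lt_iff (hκ : 0 < κ) (hQ : ‖loopGain hSR hRD HRR‖ ^ 2 ≠ 0) :
    sinrMRCLow κ ρ₂ d₁ d₂ τ hSR hRD HRR < z ↔
      1 - z * κ * ‖loopGain hSR hRD HRR‖ ^ 2 < 0 ∨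
      κ * ρ₂ / (d₁ ^ τ * d₂ ^ τ) * vecNorm hSR ^ 2 * vecNorm hRD ^ 2 < z := by
  have hQ' : 0 < ‖loopGain hSR hRD HRR‖ ^ 2 := lt_of_le_of_ne (by positivity) hQ.symm
  rw [sinrMRCLow, ← loopGain, min_lt_iff, div_lt_iff₀ (by positivity), sub_neg, ← mul_assoc]

end Thresholds

/-! ### Outage probabilities: formula, comparison and limits -/

section Model

variable {Ω : Type*} [MeasurableSpace Ω] {P : Measure Ω} [IsProbabilityMeasure P] {MR MT : ℕ}
  {σ2 : ℝ≥0} {hSR : Ω → Fin MR → ℂ} {hRD : Ω → Fin MT → ℂ} {HRR : Ω → Matrix (Fin MR) (Fin MT) ℂ}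
  {κ ρ₁ ρ₂ d₁ d₂ τ z : ℝ}

theorem IsRayleighModel.ae_vecNorm_ne_zero (h : IsRayleighModel P σ2 hSR hRD HRR) (hMR : 1 ≤ MR)
    (hMT : 1 ≤ MT) : ∀ᵐ ω ∂P, vecNorm (hSR ω) ≠ 0 := by
  have hl := h.hasLaw_loopGain hMR hMT
  refine ae_of_ae_map (p := fun q : ((Fin MR → ℂ) × (Fin MT → ℂ)) × ℂ => vecNorm q.1.1 ≠ 0)
    hl.aemeasurable ?_
  rw [hl.map_eq]
  exact Measure.quasiMeasurePreserving_fst.ae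
    (Measure.quasiMeasurePreserving_fst.ae (_root_.ae_vecNorm_ne_zero hMR))

theorem IsRayleighModel.ae_norm_loopGain_sq_ne (h : IsRayleighModel P σ2 hSR hRD HRR)
    (hMR : 1 ≤ MR) (hMT : 1 ≤ MT) (hσ2 : 0 < σ2) (a : ℝ) :
    ∀ᵐ ω ∂P, ‖loopGain (hSR ω) (hRD ω) (HRR ω)‖ ^ 2 ≠ a := by
  have hl := h.hasLaw_loopGain hMR hMT
  refine ae_of_ae_map (p := fun q : ((Fin MR → ℂ) × (Fin MT → ℂ)) × ℂ => ‖q.2‖ ^ 2 ≠ a)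
    hl.aemeasurable ?_
  rw [hl.map_eq]
  exact Measure.quasiMeasurePreserving_snd.ae (ae_complexGaussian_norm_sq_ne hσ2 a)

theorem IsRayleighModel.outageMRCLow_eq (h : IsRayleighModel P σ2 hSR hRD HRR) (hMR : 1 ≤ MR)
    (hMT : 1 ≤ MT) (hσ2 : 0 < σ2) (hκ : 0 < κ) (hρ₂ : 0 < ρ₂) (hd₁ : 0 < d₁) (hd₂ : 0 < d₂)
    (hz : 0 < z) :
    outageMRCLow P hSR hRD HRR κ d₁ d₂ τ z ρ₂ =
      1 - (1 - Real.exp (-(1 / (κ * σ2 * z)))) *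
        ((stdComplexGaussian MR).prod (stdComplexGaussian MT)).real
          {p | d₁ ^ τ * d₂ ^ τ / (ρ₂ * κ) * z ≤ vecNorm p.1 ^ 2 * vecNorm p.2 ^ 2} := by
  have hl := h.hasLaw_loopGain hMR hMT
  have hA : MeasurableSet {p : (Fin MR → ℂ) × (Fin MT → ℂ) |
      d₁ ^ τ * d₂ ^ τ / (ρ₂ * κ) * z ≤ vecNorm p.1 ^ 2 * vecNorm p.2 ^ 2} :=
    measurableSet_le measurable_const measurable_vecNorm_sq_mul_vecNorm_sq
  have hB : MeasurableSet {x : ℂ | ‖x‖ ^ 2 ≤ 1 / (κ * z)} :=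
    measurableSet_le (by fun_prop) (by fun_prop)
  -- Up to a null set, outage is the complement of a rectangle for the product law, so its
  -- probability factors.
  have hset : {ω | sinrMRCLow κ ρ₂ d₁ d₂ τ (hSR ω) (hRD ω) (HRR ω) < z} =ᵐ[P]
      {ω | ((hSR ω, hRD ω), loopGain (hSR ω) (hRD ω) (HRR ω)) ∈ ({p : (Fin MR → ℂ) × (Fin MT → ℂ) |
        d₁ ^ τ * d₂ ^ τ / (ρ₂ * κ) * z ≤ vecNorm p.1 ^ 2 * vecNorm p.2 ^ 2} ×ˢ
        {x : ℂ | ‖x‖ ^ 2 ≤ 1 / (κ * z)})ᶜ} := by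
    filter_upwards [h.ae_norm_loopGain_sq_ne hMR hMT hσ2 0] with ω hω
    apply propext
    change sinrMRCLow κ ρ₂ d₁ d₂ τ (hSR ω) (hRD ω) (HRR ω) < z ↔ ¬ (_ ∧ _)
    rw [← not_le, le_sinrMRCLow_iff hκ hρ₂ hd₁ hd₂ hz hω, and_comm]
    rfl
  have hlaw := hl.measureReal_eq (p := (· ∈ ({p : (Fin MR → ℂ) × (Fin MT → ℂ) |
    d₁ ^ τ * d₂ ^ τ / (ρ₂ * κ) * z ≤ vecNorm p.1 ^ 2 * vecNorm p.2 ^ 2} ×ˢ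
    {x : ℂ | ‖x‖ ^ 2 ≤ 1 / (κ * z)})ᶜ)) (hA.prod hB).compl
  rw [outageMRCLow, measureReal_congr hset, hlaw, Set.ofPred_mem_eq]
  rw [probReal_compl_eq_one_sub (hA.prod hB), measureReal_prod_prod,
    complexGaussian_real_norm_sq_le hσ2 (by positivity), mul_comm]
  congr 4
  have : (σ2 : ℝ) ≠ 0 := by exact_mod_cast hσ2.ne'
  field_simp

/-- If $1 - z\kappa|q|^2 < 0$, the left side of the exact first-hop condition is at most $0 < z$, so
that hop fails as well; the second-hop conditions coincide. -/
theorem IsRayleighModel.outageMRCLow_le (h : IsRayleighModel P σ2 hSR hRD HRR) (hMR : 1 ≤ MR)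
    (hMT : 1 ≤ MT) (hσ2 : 0 < σ2) (hκ : 0 < κ) (hρ₁ : 0 < ρ₁) (hd₁ : 0 < d₁) (hz : 0 < z) :
    outageMRCLow P hSR hRD HRR κ d₁ d₂ τ z ρ₂ ≤ outageMRC P hSR hRD HRR κ d₁ d₂ τ z ρ₁ ρ₂ := by
  refine ENNReal.toReal_mono (measure_ne_top _ _) (measure_mono_ae ?_)
  filter_upwards [h.ae_norm_loopGain_sq_ne hMR hMT hσ2 0] with ω hω
  change sinrMRCLow κ ρ₂ d₁ d₂ τ (hSR ω) (hRD ω) (HRR ω) < z →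
    sinrMRC κ ρ₁ ρ₂ d₁ d₂ τ (hSR ω) (hRD ω) (HRR ω) < z
  rw [sinrMRCLow_lt_iff hκ hω, sinrMRC_lt_iff hκ hρ₁ hd₁]
  refine Or.imp_left fun h1 => lt_of_le_of_lt ?_ hz
  have h2 : 0 < d₁ ^ τ := Real.rpow_pos_of_pos hd₁ τ
  exact mul_nonpos_of_nonneg_of_nonpos (by positivity)
    (mul_nonpos_of_nonneg_of_nonpos (by positivity) h1.le)

/-- An exact outage that is not a noise-free one has $0 \le Y < z d_1^\tau/\rho_1$. The error term
is free of $\rho_2$, which is the source of uniformity. -/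
theorem IsRayleighModel.outageMRC_le (h : IsRayleighModel P σ2 hSR hRD HRR) (hMR : 1 ≤ MR)
    (hMT : 1 ≤ MT) (hσ2 : 0 < σ2) (hκ : 0 < κ) (hρ₁ : 0 < ρ₁) (hd₁ : 0 < d₁) :
    outageMRC P hSR hRD HRR κ d₁ d₂ τ z ρ₁ ρ₂ ≤ outageMRCLow P hSR hRD HRR κ d₁ d₂ τ z ρ₂ +
      P.real {ω | |vecNorm (hSR ω) ^ 2 *
        (1 - z * κ * ‖loopGain (hSR ω) (hRD ω) (HRR ω)‖ ^ 2)| < z / (ρ₁ / d₁ ^ τ)} := by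
  refine le_trans (ENNReal.toReal_mono (measure_ne_top _ _) (measure_mono_ae ?_))
    (measureReal_union_le _ _)
  filter_upwards [h.ae_norm_loopGain_sq_ne hMR hMT hσ2 0] with ω hω
  change sinrMRC κ ρ₁ ρ₂ d₁ d₂ τ (hSR ω) (hRD ω) (HRR ω) < z →
    sinrMRCLow κ ρ₂ d₁ d₂ τ (hSR ω) (hRD ω) (HRR ω) < z ∨ |(_ : ℝ)| < _
  have h2 : 0 < d₁ ^ τ := Real.rpow_pos_of_pos hd₁ τ
  rw [sinrMRCLow_lt_iff hκ hω, sinrMRC_lt_iff hκ hρ₁ hd₁]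
  rintro (h1 | h1)
  · rcases lt_or_ge (1 - z * κ * ‖loopGain (hSR ω) (hRD ω) (HRR ω)‖ ^ 2) 0 with h3 | h3
    · exact Or.inl (Or.inl h3)
    · right
      rwa [abs_of_nonneg (by positivity), lt_div_iff₀' (by positivity)]
  · exact Or.inl (Or.inr h1)

/-- $Y$ vanishes only if `hSR` has norm zero or $|q|^2 = 1/(z\kappa)$, and both events are null. -/
theorem IsRayleighModel.tendsto_measureReal_near_threshold (h : IsRayleighModel P σ2 hSR hRD HRR)
    (hMR : 1 ≤ MR) (hMT : 1 ≤ MT) (hσ2 : 0 < σ2) (hκ : 0 < κ) (hd₁ : 0 < d₁) (hz : 0 < z) :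
    Tendsto (fun ρ₁ : ℝ => P.real {ω | |vecNorm (hSR ω) ^ 2 *
        (1 - z * κ * ‖loopGain (hSR ω) (hRD ω) (HRR ω)‖ ^ 2)| < z / (ρ₁ / d₁ ^ τ)})
      atTop (𝓝 0) := by
  have h2 : 0 < d₁ ^ τ := Real.rpow_pos_of_pos hd₁ τ
  have hY : AEMeasurable (fun ω => vecNorm (hSR ω) ^ 2 *
      (1 - z * κ * ‖loopGain (hSR ω) (hRD ω) (HRR ω)‖ ^ 2)) P := by
    have hm : Measurable fun q : ((Fin MR → ℂ) × (Fin MT → ℂ)) × ℂ =>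
        vecNorm q.1.1 ^ 2 * (1 - z * κ * ‖q.2‖ ^ 2) :=
      ((measurable_vecNorm.comp (measurable_fst.comp measurable_fst)).pow_const 2).mul
        (measurable_const.sub (measurable_const.mul (measurable_snd.norm.pow_const 2)))
    have hc := hm.comp_aemeasurable (h.hasLaw_loopGain hMR hMT).aemeasurable
    simpa only [Function.comp_def] using hc
  have h0 := tendsto_measureReal_abs_lt_zero hY (by
    filter_upwards [h.ae_vecNorm_ne_zero hMR hMT,
      h.ae_norm_loopGain_sq_ne hMR hMT hσ2 (1 / (z * κ))] with ω h3 h4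
    refine mul_ne_zero (pow_ne_zero 2 h3) fun h5 => h4 ?_
    field_simp
    linarith)
  refine h0.comp (tendsto_nhdsWithin_iff.2 ⟨?_, ?_⟩)
  · exact (tendsto_id.atTop_div_const h2).const_div_atTop z
  · filter_upwards [eventually_gt_atTop 0] with ρ hρ
    exact Set.mem_Ioi.2 (by positivity)

theorem IsRayleighModel.tendsto_outageMRCLow (h : IsRayleighModel P σ2 hSR hRD HRR) (hMR : 1 ≤ MR)
    (hMT : 1 ≤ MT) (hσ2 : 0 < σ2) (hκ : 0 < κ) (hd₁ : 0 < d₁) (hd₂ : 0 < d₂) (hz : 0 < z) :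
    Tendsto (fun ρ₂ : ℝ => outageMRCLow P hSR hRD HRR κ d₁ d₂ τ z ρ₂) atTop
      (𝓝 (Real.exp (-(1 / (κ * σ2 * z))))) := by
  have h1 : 0 < d₁ ^ τ := Real.rpow_pos_of_pos hd₁ τ
  have h2 : 0 < d₂ ^ τ := Real.rpow_pos_of_pos hd₂ τ
  have hc : Tendsto (fun ρ₂ : ℝ => d₁ ^ τ * d₂ ^ τ / (ρ₂ * κ) * z) atTop (𝓝[>] 0) := by
    refine tendsto_nhdsWithin_iff.2 ⟨?_, ?_⟩
    · simpa using ((tendsto_id.atTop_mul_const hκ).const_div_atTop (d₁ ^ τ * d₂ ^ τ)).mul_const z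
    · filter_upwards [eventually_gt_atTop 0] with ρ hρ
      exact Set.mem_Ioi.2 (by positivity)
  have ht := (((tendsto_stdComplexGaussian_prod_real_ge hMR hMT).comp hc).const_mul
    (1 - Real.exp (-(1 / (κ * σ2 * z))))).const_sub 1
  rw [mul_one, sub_sub_cancel] at ht
  refine ht.congr' ?_
  filter_upwards [eventually_gt_atTop 0] with ρ hρ
  rw [h.outageMRCLow_eq hMR hMT hσ2 hκ hρ hd₁ hd₂ hz]
  rfl

theorem IsRayleighModel.exists_abs_outageMRC_sub_lt (h : IsRayleighModel P σ2 hSR hRD HRR)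
    (hMR : 1 ≤ MR) (hMT : 1 ≤ MT) (hσ2 : 0 < σ2) (hκ : 0 < κ) (hd₁ : 0 < d₁) (hz : 0 < z)
    {ε : ℝ} (hε : 0 < ε) : ∃ r : ℝ, ∀ ρ₁ ρ₂ : ℝ, r ≤ ρ₁ → 0 < ρ₂ →
      |outageMRC P hSR hRD HRR κ d₁ d₂ τ z ρ₁ ρ₂ -
        outageMRCLow P hSR hRD HRR κ d₁ d₂ τ z ρ₂| < ε := by
  obtain ⟨r, hr⟩ := eventually_atTop.1 (((h.tendsto_measureReal_near_threshold hMR hMT hσ2 hκ hd₁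
    hz (τ := τ)).eventually (gt_mem_nhds hε)).and (eventually_gt_atTop 0))
  refine ⟨r, fun ρ₁ ρ₂ h1 _ => ?_⟩
  obtain ⟨h3, h4⟩ := hr ρ₁ h1
  rw [abs_of_nonneg (sub_nonneg.2 (h.outageMRCLow_le hMR hMT hσ2 hκ h4 hd₁ hz))]
  have := h.outageMRC_le hMR hMT hσ2 hκ h4 hd₁ (ρ₂ := ρ₂) (d₂ := d₂) (z := z) (τ := τ)
  linarith

/-- Uniformity in $\rho_2$ turns the two successive limits into a joint one, with no relation
imposed between the rates of $\rho_1$ and $\rho_2$. -/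
theorem IsRayleighModel.tendsto_outageMRC (h : IsRayleighModel P σ2 hSR hRD HRR) (hMR : 1 ≤ MR)
    (hMT : 1 ≤ MT) (hσ2 : 0 < σ2) (hκ : 0 < κ) (hd₁ : 0 < d₁) (hd₂ : 0 < d₂) (hz : 0 < z) :
    Tendsto (fun ρ : ℝ × ℝ => outageMRC P hSR hRD HRR κ d₁ d₂ τ z ρ.1 ρ.2) (atTop ×ˢ atTop)
      (𝓝 (Real.exp (-(1 / (κ * σ2 * z))))) := by
  have hdiff : Tendsto (fun ρ : ℝ × ℝ => outageMRC P hSR hRD HRR κ d₁ d₂ τ z ρ.1 ρ.2 -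
      outageMRCLow P hSR hRD HRR κ d₁ d₂ τ z ρ.2) (atTop ×ˢ atTop) (𝓝 0) := by
    refine Metric.tendsto_nhds.2 fun ε hε => ?_
    obtain ⟨r, hr⟩ := h.exists_abs_outageMRC_sub_lt hMR hMT hσ2 hκ hd₁ hz hε (d₂ := d₂) (τ := τ)
    filter_upwards [(eventually_ge_atTop r).prod_mk (eventually_gt_atTop (0 : ℝ))] with ρ hρ
    rw [Real.dist_eq, sub_zero]
    exact hr _ _ hρ.1 hρ.2
  simpa using hdiff.add ((h.tendsto_outageMRCLow hMR hMT hσ2 hκ hd₁ hd₂ hz (τ := τ)).comp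
    (tendsto_snd (f := atTop)))

end Model

/-! ### Zero diversity and conclusion -/

/-- Positivity of the limit keeps $\log P_{\mathrm{out}}$ convergent, while $\log P_S \to \infty$.
-/
theorem hasDiversityOrder_zero_of_tendsto {Pout : ℝ → ℝ} {p : ℝ} (hp : 0 < p)
    (h : Tendsto Pout atTop (𝓝 p)) : HasDiversityOrder Pout 0 :=
  (h.log hp.ne').neg.div_atTop Real.tendsto_log_atTop

theorem proposition7 {Ω : Type*} [MeasurableSpace Ω] (P : Measure Ω) [IsProbabilityMeasure P]
    (MR : ℕ) (hMR : 1 ≤ MR) (σ2 : ℝ≥0) (hσ2 : 0 < σ2)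
    (hSR : Ω → Fin MR → ℂ) (hRD : Ω → Fin 1 → ℂ) (HRR : Ω → Matrix (Fin MR) (Fin 1) ℂ)
    (hmodel : IsRayleighModel P σ2 hSR hRD HRR)
    (η α κ d₁ d₂ τ z : ℝ) (hη : 0 < η) (hα₀ : 0 < α) (hα₁ : α < 1) (hκ : κ = harvestRatio η α)
    (hd₁ : 0 < d₁) (hd₂ : 0 < d₂) (hz : 0 < z) :
    -- closed form of the outage probability with noise-free first hop
    (∀ ρ₂ : ℝ, 0 < ρ₂ →
      (outageMRCLow P hSR hRD HRR κ d₁ d₂ τ z ρ₂ : ℂ) =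
        1 - ((2 / Real.Gamma MR : ℝ) : ℂ) *
          meijerG 2 1 ![1, (MR : ℂ)] ![1, (MR : ℂ), 0] ((1 / (κ * σ2 * z) : ℝ) : ℂ) *
          (((d₁ ^ τ * d₂ ^ τ / (ρ₂ * κ) * z) ^ ((MR : ℝ) / 2) *
            besselK MR (2 * √(d₁ ^ τ * d₂ ^ τ / (ρ₂ * κ) * z)) : ℝ) : ℂ)) ∧
    -- it is a lower bound for the exact outage probability
    (∀ ρ₁ ρ₂ : ℝ, 0 < ρ₁ → 0 < ρ₂ →
      outageMRCLow P hSR hRD HRR κ d₁ d₂ τ z ρ₂ ≤ outageMRC P hSR hRD HRR κ d₁ d₂ τ z ρ₁ ρ₂) ∧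
    -- and approximates it at high SNR
    (∀ ε : ℝ, 0 < ε → ∃ r : ℝ, ∀ ρ₁ ρ₂ : ℝ, r ≤ ρ₁ → 0 < ρ₂ →
      |outageMRC P hSR hRD HRR κ d₁ d₂ τ z ρ₁ ρ₂ -
        outageMRCLow P hSR hRD HRR κ d₁ d₂ τ z ρ₂| < ε) ∧
    -- outage floor
    (∃ p : ℝ, 0 < p ∧
      (p : ℂ) =
        1 - meijerG 2 1 ![1, (MR : ℂ)] ![1, (MR : ℂ), 0] ((1 / (κ * σ2 * z) : ℝ) : ℂ) ∧
      Tendsto (fun ρ₂ : ℝ => outageMRCLow P hSR hRD HRR κ d₁ d₂ τ z ρ₂) atTop (𝓝 p) ∧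
      Tendsto (fun ρ : ℝ × ℝ => outageMRC P hSR hRD HRR κ d₁ d₂ τ z ρ.1 ρ.2)
        (atTop ×ˢ atTop) (𝓝 p)) ∧
    -- zero diversity, for all positive noise powers at the relay and at the destination
    (∀ σR2 σD2 : ℝ, 0 < σR2 → 0 < σD2 →
      HasDiversityOrder
        (fun PS => outageMRCLow P hSR hRD HRR κ d₁ d₂ τ z (PS / σD2)) 0 ∧
      HasDiversityOrder
        (fun PS => outageMRC P hSR hRD HRR κ d₁ d₂ τ z (PS / σR2) (PS / σD2)) 0) := by
  subst hκ
  have hκ := harvestRatio_pos hη hα₀ hα₁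
  have h1 : 0 < d₁ ^ τ := Real.rpow_pos_of_pos hd₁ τ
  have h2 : 0 < d₂ ^ τ := Real.rpow_pos_of_pos hd₂ τ
  have hσ : (0 : ℝ) < σ2 := by exact_mod_cast hσ2
  have hG := meijerG_eq_one_sub_exp_neg hMR
    (x := 1 / (harvestRatio η α * σ2 * z)) (by positivity)
  have hlow := hmodel.tendsto_outageMRCLow hMR le_rfl hσ2 hκ hd₁ hd₂ hz (τ := τ)
  have hexact := hmodel.tendsto_outageMRC hMR le_rfl hσ2 hκ hd₁ hd₂ hz (τ := τ)
  have hp := Real.exp_pos (-(1 / (harvestRatio η α * σ2 * z)))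
  refine ⟨fun ρ₂ hρ₂ => ?_, fun ρ₁ ρ₂ hρ₁ _ =>
    hmodel.outageMRCLow_le hMR le_rfl hσ2 hκ hρ₁ hd₁ hz,
    fun ε hε => hmodel.exists_abs_outageMRC_sub_lt hMR le_rfl hσ2 hκ hd₁ hz hε,
    ⟨_, hp, ?_, hlow, hexact⟩, fun σR2 σD2 hσR2 hσD2 => ⟨?_, ?_⟩⟩
  · rw [hmodel.outageMRCLow_eq hMR le_rfl hσ2 hκ hρ₂ hd₁ hd₂ hz,
      stdComplexGaussian_prod_real_ge hMR (by positivity), hG]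
    push_cast
    ring
  · rw [hG]
    push_cast
    ring
  · exact hasDiversityOrder_zero_of_tendsto hp
      (hlow.comp (tendsto_id.atTop_div_const hσD2))
  -- Both SNRs grow along a fixed ray, a special case of the joint limit.
  · have ht : Tendsto (fun PS : ℝ => (PS / σR2, PS / σD2)) atTop (atTop ×ˢ atTop) :=
      (tendsto_id.atTop_div_const hσR2).prodMk (tendsto_id.atTop_div_const hσD2)
    have hc := hexact.comp ht
    simp only [Function.comp_def] at hc
    exact hasDiversityOrder_zero_of_tendsto hp hc
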